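/- A chord diagram with $n\ge 0$ chords on one backbone is a perfect matching of the points $1,\dots,2n$, written as a fixed-point-free involution $\iota\in S_{2n}$. Let $\tau=(1,2,\dots,2n)$ and let $r$ be the number of cycles (fixed points included) of $\tau\circ\iota$, with the convention $r=1$ if $n=0$. This $r$ is the number of boundary components of the surface of the fatgraph obtained from the diagram by collapsing the backbone to a point, and the genus $g\geq 0$ of the diagram is defined by $1-n=2-2g-r$. Let $\mathbf c_g(n)$ be the number of chord diagrams of genus $g$ with $n$ chords on one backbone, and let $\mathbf C_g(z)=\sum_{n\ge 0}\mathbf c_g(n)z^n$. **Lemma.** For every integer $g\ge 1$ there is a unique polynomial $P_g$ with integer coefficients such that, as formal power series in $z$, $$\mathbf C_g(z)=P_g(z)\,(1-4z)^{\frac12-3g},$$ and it satisfies $$P_g(1/4)=\Bigl(\frac94\Bigr)^{g}\,\frac{\Gamma(g-1/6)\,\Gamma(g+1/2)\,\Gamma(g+1/6)}{6\,\pi^{3/2}\,\Gamma(g+1)}.$$ -/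

import Mathlib

/-- A chord diagram with `n` chords on one backbone. The backbone has `2 * n` vertices, and every
vertex is an endpoint of exactly one chord, so the chords form a perfect matching of the vertices
`0, …, 2 * n - 1` (listed from left to right). The matching is recorded as the fixed-point free
involution `ι` that exchanges the two endpoints of each chord. -/
abbrev ChordDiagram (n : ℕ) : Type :=
  {ι : Equiv.Perm (Fin (2 * n)) // ∀ i, ι (ι i) = i ∧ ι i ≠ i}

namespace ChordDiagram

/-- The number of boundary components of the surface of the fatgraph obtained by collapsing the
backbone to a point. This fatgraph has one vertex, its half-edges are the chord ends in the
cyclic order `τ = (0, 1, …, 2 * n - 1)`, and its edges are the chords, so the boundary components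
are the cycles (fixed points included) of `τ ∘ ι`. Without chords the surface is a disc, which has
one boundary component, although there are no half-edges. -/
noncomputable def boundaryCount {n : ℕ} (C : ChordDiagram n) : ℕ :=
  if n = 0 then 1
  else Nat.card (Quotient (Equiv.Perm.SameCycle.setoid (finRotate (2 * n) * C.1)))

/-- The surface of the chord diagram has genus `g`. The collapsed fatgraph is connected, with one
vertex and `n` edges, so its Euler characteristic `1 - n` equals `2 - 2 g - r`, where `r` is the
number of boundary components. -/
def HasGenus {n : ℕ} (C : ChordDiagram n) (g : ℕ) : Prop :=
  (1 : ℤ) - n = 2 - 2 * g - C.boundaryCount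

end ChordDiagram

/-- `chordCount g n` is the number of chord diagrams of genus `g` with `n` chords on one
backbone. -/
noncomputable def chordCount (g n : ℕ) : ℕ :=
  Nat.card {C : ChordDiagram n // C.HasGenus g}

/-- The generating function `C_g(z) = ∑ n, c_g(n) z ^ n`. -/
noncomputable def chordSeries (g : ℕ) : PowerSeries ℚ :=
  PowerSeries.mk fun n => (chordCount g n : ℚ)

/-- The power series `(1 - 4 z) ^ s`, that is, the binomial series `(1 + z) ^ s` with `-4 z`
substituted for `z`. -/
noncomputable def oneSubFourPow (s : ℚ) : PowerSeries ℚ :=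
  PowerSeries.rescale (-4 : ℚ) (PowerSeries.binomialSeries ℚ s)

/-- `P` is the numerator polynomial of genus `g`:
`C_g(z) = P(z) * (1 - 4 z) ^ (1 / 2 - 3 g)`. -/
def IsNumerator (g : ℕ) (P : Polynomial ℤ) : Prop :=
  chordSeries g =
    ((P.map (Int.castRingHom ℚ) : Polynomial ℚ) : PowerSeries ℚ) *
      oneSubFourPow (1 / 2 - 3 * (g : ℚ))

/-!
The proof rests on the Harer–Zagier recursion
`(n + 1) c_g(n) = 2 (2 n - 1) c_g(n - 1) + (2 n - 1) (2 n - 3) (n - 1) c_{g - 1}(n - 2)`,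
which is `chordCount_rec` with `n` shifted by two.

For its proof, `N ^ r` counts the colourings of the `2 n` chord ends by `N` colours that are
constant on the cycles of `τ ∘ ι`, that is, those `c` with `c ∘ τ = c ∘ ι`. Such a colouring turns
the backbone into a closed walk on the colours which takes the step from `c x` to `c (ι x)` at the
chord end `x`: an Eulerian trail that passes every chord once in each direction. Averaging over all
labellings of the chord ends, `ι` can be kept fixed while `τ` varies, and for fixed `ι` and `c` the
trails are counted by the BEST theorem, in the determinantal form `trailCount_eq_det`, as a product
of factorials times a minor of the Laplacian of the graph of coloured chords. To sum over `c`, the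
factorials are encoded by a linear functional on polynomials in one variable per colour. Expanding
the minors along their rows gives a closed form for the sum of the monomials
(`sum_weight_mul_det_colourLaplacian`), and the functional is evaluated by adding one point at a
time (`sum_trailCount`). The outcome, `ChordDiagram.sum_pow_boundaryCount`, is the Harer–Zagier
formula `∑ N ^ r = (2 n - 1)!! ∑ k, 2 ^ k C(n, k) C(N, k + 1)`, where the sum on the left runs over
all diagrams. Comparing the coefficients of `N ^ r` in the three-term recursion in `n` of these
polynomials gives the recursion for `c_g(n)`.

In the basis `f_j = z ^ j (1 - 4 z) ^ (-j - 1 / 2)`, the differential operator on the side of `C_g`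
is diagonal, with eigenvalues `j + 1`, and the operator on the side of `C_{g - 1}` sends `f_j` to
`(2 j + 1) (2 j + 3) ((j + 1) f_{j + 2} + (4 j + 10) f_{j + 3})`. Since `C_1 = f_2`, every `C_g`
with `g ≥ 1` is a combination of the `f_j` with `j ≤ 3 g - 1`, which is the claimed form. The
numerator is integral because `(1 - 4 z) ^ (3 g - 1 / 2)` has integer coefficients. At `z = 1 / 4`
only the coefficient of `f_{3 g - 1}` matters, and its first-order recursion in `g` is the one of
the product of Gamma values.
-/

/-! ### Counting Eulerian trails -/

section Trails

variable {V ε : Type*}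

/-- `f` lists the directed edges of a trail from `u` to `r`: `s` and `t` give the source and the
target of an edge, the first edge starts at `u`, each edge starts where the one before it ends,
and the last edge ends at `r`. The empty trail exists only for `u = r`. -/
def IsTrail (s t : ε → V) (r : V) : (k : ℕ) → (Fin k → ε) → V → Prop
  | 0, _, u => u = r
  | k + 1, f, u => s (f 0) = u ∧ IsTrail s t r k (Fin.tail f) (t (f 0))

lemma isTrail_succ_iff (s t : ε → V) (r : V) (k : ℕ) (f : Fin (k + 1) → ε) (u : V) :
    IsTrail s t r (k + 1) f u ↔
      s (f 0) = u ∧ (∀ i : Fin k, t (f i.castSucc) = s (f i.succ)) ∧ t (f (Fin.last k)) = r := by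
  induction k generalizing u with
  | zero => simp [IsTrail]
  | succ k ih =>
    rw [IsTrail, ih, Fin.forall_fin_succ (n := k)]
    simp only [Fin.tail, Fin.succ_last, Fin.castSucc_zero, Fin.succ_castSucc, Fin.succ_zero_eq_one]
    constructor
    · rintro ⟨h1, h2, h3, h4⟩
      exact ⟨h1, ⟨h2.symm, h3⟩, h4⟩
    · rintro ⟨h1, ⟨h2, h3⟩, h4⟩
      exact ⟨h1, h2.symm, h3, h4⟩

open scoped Classical in
/-- The number of trails from `u` to `r` that consist of `k` distinct edges of `E`; for
`k = #E` these are the Eulerian trails of the multidigraph `E`. -/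
noncomputable def trailCount [Fintype ε] (s t : ε → V) (r : V) (k : ℕ) (u : V) (E : Finset ε) : ℤ :=
  ∑ f : Fin k → ε, if Function.Injective f ∧ (∀ i, f i ∈ E) ∧ IsTrail s t r k f u then 1 else 0

open scoped Classical in
lemma trailCount_succ [Fintype ε] (s t : ε → V) (r : V) (k : ℕ) (u : V) (E : Finset ε) :
    trailCount s t r (k + 1) u E =
      ∑ e ∈ E with s e = u, trailCount s t r k (t e) (E.erase e) := by
  have hcons : ∀ (e : ε) (g : Fin k → ε),
      (Function.Injective (Fin.cons e g : Fin (k + 1) → ε) ∧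
        (∀ i, (Fin.cons e g : Fin (k + 1) → ε) i ∈ E) ∧ IsTrail s t r (k + 1) (Fin.cons e g) u) ↔
      (e ∈ E ∧ s e = u) ∧
        (Function.Injective g ∧ (∀ i, g i ∈ E.erase e) ∧ IsTrail s t r k g (t e)) := by
    intro e g
    rw [Fin.cons_injective_iff, IsTrail, Fin.forall_fin_succ]
    simp only [Fin.cons_zero, Fin.cons_succ, Fin.tail_cons, Finset.mem_erase, Set.mem_range,
      not_exists, forall_and]
    tauto
  rw [Finset.sum_filter, trailCount, ← (Fin.consEquiv fun _ => ε).sum_comp, Fintype.sum_prod_type,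
    ← Finset.sum_subset (Finset.subset_univ E)]
  · refine Finset.sum_congr rfl fun e he => ?_
    simp only [Fin.consEquiv, Equiv.coe_fn_mk, hcons, he, true_and]
    by_cases hs : s e = u
    · simp [hs, trailCount]
    · simp [hs]
  · intro e _ he
    simp [Fin.consEquiv, hcons, he]

open scoped Classical in
/-- The number of edges of `E` that leave `v`. -/
noncomputable def outDeg (s : ε → V) (E : Finset ε) (v : V) : ℕ := (E.filter (s · = v)).card

open scoped Classical in
lemma outDeg_erase (s : ε → V) {E : Finset ε} {e : ε} (he : e ∈ E) (v : V) :
    outDeg s (E.erase e) v + (if v = s e then 1 else 0) = outDeg s E v := by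
  unfold outDeg
  rw [Finset.filter_erase]
  split_ifs with h
  · rw [Finset.card_erase_add_one]
    simp [he, h]
  · rw [Finset.erase_eq_of_notMem, add_zero]
    simp [Ne.symm h]

open scoped Classical in
lemma outDeg_erase_of_ne (s : ε → V) {E : Finset ε} {e : ε} {v : V} (h : s e ≠ v) :
    (E.erase e).filter (s · = v) = E.filter (s · = v) := by
  rw [Finset.filter_erase, Finset.erase_eq_of_notMem]
  simp [h]

open scoped Classical in
/-- The Laplacian (out-degrees minus adjacencies) of the multidigraph `E`, with the row and the
column of the root `r` deleted. A vertex without outgoing edges gets the row of the identity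
matrix, so that vertices which `E` does not meet leave the determinant unchanged. -/
noncomputable def reducedLaplacian (s t : ε → V) (r : V) (E : Finset ε) :
    Matrix {v // v ≠ r} {v // v ≠ r} ℤ := fun v w =>
  if outDeg s E v = 0 then (if v = w then 1 else 0)
  else ∑ e ∈ E with s e = v, ((if v = w then 1 else 0) - if t e = w then 1 else 0)

open scoped Classical in
/-- The number of ways to order the outgoing edges at every vertex, where the last edge out of a
vertex other than the root `r` is prescribed. A vertex without outgoing edges contributes the
factor `(0 - 1)! = 1`, with truncated subtraction. -/
noncomputable def exitOrders [Fintype V] (s : ε → V) (r : V) (E : Finset ε) : ℤ :=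
  (outDeg s E r).factorial * ∏ v : {v // v ≠ r}, ((outDeg s E v - 1).factorial : ℤ)

open scoped Classical in
/-- In-degrees and out-degrees are those of a multidigraph whose edges form a trail from `u`
to `r`. -/
def TrailBalanced (s t : ε → V) (r u : V) (E : Finset ε) : Prop :=
  ∀ v, outDeg s E v + (if v = r then 1 else 0) = outDeg t E v + (if v = u then 1 else 0)

open scoped Classical in
lemma TrailBalanced.erase {s t : ε → V} {r u : V} {E : Finset ε} (h : TrailBalanced s t r u E)
    {e : ε} (he : e ∈ E) (hs : s e = u) : TrailBalanced s t r (t e) (E.erase e) := by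
  intro v
  have h1 := outDeg_erase s he v
  have h2 := outDeg_erase t he v
  have h3 := h v
  rw [hs] at h1
  omega

open scoped Classical in
lemma reducedLaplacian_erase_root (s t : ε → V) (r : V) {E : Finset ε} {e : ε}
    (hs : s e = r) : reducedLaplacian s t r (E.erase e) = reducedLaplacian s t r E := by
  classical
  ext v w
  have : s e ≠ v := by rw [hs]; exact v.2.symm
  unfold reducedLaplacian
  rw [outDeg_erase_of_ne s this]
  unfold outDeg
  rw [outDeg_erase_of_ne s this]

open scoped Classical in
lemma reducedLaplacian_erase (s t : ε → V) {r : V} {E : Finset ε} {e : ε} (he : e ∈ E)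
    (u : {v // v ≠ r}) (hs : s e = u) :
    reducedLaplacian s t r (E.erase e) = (reducedLaplacian s t r E).updateRow u
      (if outDeg s E u = 1 then fun w => if u = w then 1 else 0
      else reducedLaplacian s t r E u -
        fun w => (if u = w then 1 else 0) - if t e = w then 1 else 0) := by
  ext v w
  by_cases hv : v = u
  · subst hv
    rw [Matrix.updateRow_self]
    have h1 := outDeg_erase s he v
    rw [if_pos hs.symm] at h1
    by_cases h0 : outDeg s E v = 1
    · rw [if_pos h0]
      unfold reducedLaplacian
      rw [if_pos (by omega)]
    · rw [if_neg h0, Pi.sub_apply]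
      unfold reducedLaplacian
      rw [if_neg (show ¬outDeg s (E.erase e) v = 0 by omega),
        if_neg (show ¬outDeg s E v = 0 by omega), Finset.filter_erase,
        ← Finset.sum_erase_add (E.filter (s · = v)) _ (a := e) (by simp [he, hs])]
      ring
  · rw [Matrix.updateRow_ne hv]
    have : s e ≠ v := by rw [hs]; exact fun h => hv (Subtype.ext h.symm)
    unfold reducedLaplacian
    rw [outDeg_erase_of_ne s this]
    unfold outDeg
    rw [outDeg_erase_of_ne s this]

variable [Fintype V]

open scoped Classical in
lemma exitOrders_erase_root (s : ε → V) (r : V) {E : Finset ε} {e : ε} (he : e ∈ E)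
    (hs : s e = r) : outDeg s E r * exitOrders s r (E.erase e) = exitOrders s r E := by
  classical
  have h1 := outDeg_erase s he r
  have h2 : ∀ v : {v // v ≠ r}, outDeg s (E.erase e) v = outDeg s E v := by
    intro v
    have := outDeg_erase s he v
    rw [if_neg (by rw [hs]; exact v.2)] at this
    exact this
  rw [if_pos hs.symm] at h1
  unfold exitOrders
  simp only [h2]
  rw [← h1, Nat.factorial_succ]
  push_cast
  ring

open scoped Classical in
lemma exitOrders_erase (s : ε → V) {r : V} {E : Finset ε} {e : ε} (he : e ∈ E)
    (u : {v // v ≠ r}) (hs : s e = u) :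
    exitOrders s r E =
      (if outDeg s E u = 1 then 1 else ((outDeg s E u : ℤ) - 1)) * exitOrders s r (E.erase e) := by
  classical
  have h1 := outDeg_erase s he u
  rw [if_pos hs.symm] at h1
  have h2 : ∀ v : V, v ≠ u → outDeg s (E.erase e) v = outDeg s E v := by
    intro v hv
    have := outDeg_erase s he v
    rw [if_neg (by rw [hs]; exact hv)] at this
    exact this
  unfold exitOrders
  rw [h2 r u.2.symm, ← Finset.mul_prod_erase _ _ (Finset.mem_univ u),
    ← Finset.mul_prod_erase Finset.univ
      (fun v : {v // v ≠ r} => ((outDeg s (E.erase e) v - 1).factorial : ℤ)) (Finset.mem_univ u),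
    Finset.prod_congr rfl (g := fun v : {v // v ≠ r} => ((outDeg s E v - 1).factorial : ℤ))
      (s₁ := Finset.univ.erase u)
      (f := fun v : {v // v ≠ r} => ((outDeg s (E.erase e) v - 1).factorial : ℤ))
      fun v hv => by rw [h2 v (fun h => (Finset.mem_erase.1 hv).1 (Subtype.ext h))]]
  rw [← h1]
  generalize outDeg s (E.erase e) u = a
  rcases a with _ | a
  · simp
  · simp only [Nat.add_sub_cancel, Nat.factorial_succ]
    rw [if_neg (by omega)]
    push_cast
    ring

open scoped Classical in
/-- Leaving a vertex `u ≠ r`: the Laplacian is linear in the row of `u`, which is the sum of one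
vector for each outgoing edge, so deleting the edges in turn gives `outDeg u - 1` copies of the
determinant. If there is only one edge, then `u` has no incoming edge and can be dropped. -/
lemma sum_det_reducedLaplacian_erase (s t : ε → V) {r : V} {E : Finset ε}
    (u : {v // v ≠ r}) (h : TrailBalanced s t r u E) :
    ∑ e ∈ E with s e = u, (reducedLaplacian s t r (E.erase e)).det =
      (if outDeg s E u = 1 then 1 else ((outDeg s E u : ℤ) - 1)) *
        (reducedLaplacian s t r E).det := by
  have hu := h u
  rw [if_neg u.2, if_pos rfl, add_zero] at hu
  have hrow : reducedLaplacian s t r E u = ∑ e ∈ E with s e = u,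
      (fun w : {v // v ≠ r} => ((if u = w then 1 else 0) - if t e = w then 1 else 0 : ℤ)) := by
    ext w
    rw [Finset.sum_apply]
    unfold reducedLaplacian
    rw [if_neg (by omega)]
  have hself : (reducedLaplacian s t r E).det = ∑ e ∈ E with s e = u,
      ((reducedLaplacian s t r E).updateRow u
      (fun w : {v // v ≠ r} => ((if u = w then 1 else 0) - if t e = w then 1 else 0 : ℤ))).det := by
    conv_lhs => rw [← Matrix.updateRow_eq_self (reducedLaplacian s t r E) u, hrow]
    exact MultilinearMap.map_update_sum Matrix.detRowAlternating.toMultilinearMap _ u _ _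
  have hsub : ∀ x y : {v // v ≠ r} → ℤ,
      ((reducedLaplacian s t r E).updateRow u (x - y)).det =
        ((reducedLaplacian s t r E).updateRow u x).det -
          ((reducedLaplacian s t r E).updateRow u y).det :=
    (Matrix.detRowAlternating (n := {v // v ≠ r}) (R := ℤ)).map_update_sub
      (reducedLaplacian s t r E) u
  rw [Finset.sum_congr rfl fun e he => by
    rw [reducedLaplacian_erase s t (Finset.mem_filter.1 he).1 u (Finset.mem_filter.1 he).2]]
  by_cases h1 : outDeg s E u = 1
  · simp only [if_pos h1]
    rw [one_mul, hself]
    refine Finset.sum_congr rfl fun e he => ?_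
    have hin : outDeg t E u = 0 := by omega
    rw [outDeg, Finset.card_eq_zero, Finset.filter_eq_empty_iff] at hin
    have hx : (fun w : {v // v ≠ r} => ((if u = w then 1 else 0) - if t e = w then 1 else 0 : ℤ)) =
        (fun w : {v // v ≠ r} => if u = w then 1 else 0) -
          (fun w : {v // v ≠ r} => if t e = w then 1 else 0) := rfl
    rw [hx, hsub]
    refine (sub_eq_self.2 ?_).symm
    -- No edge enters `u`, so the column of `u` vanishes outside its diagonal entry.
    refine Matrix.det_eq_zero_of_column_eq_zero u fun v => ?_
    by_cases hv : v = u
    · subst hv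
      rw [Matrix.updateRow_self]
      exact if_neg (hin (Finset.mem_filter.1 he).1)
    · rw [Matrix.updateRow_ne hv]
      unfold reducedLaplacian
      rw [if_neg hv, ite_eq_left_iff]
      intro _
      refine Finset.sum_eq_zero fun e' he' => ?_
      rw [if_neg (hin (Finset.mem_filter.1 he').1), sub_zero]
  · simp only [if_neg h1, hsub, Matrix.updateRow_eq_self]
    rw [Finset.sum_sub_distrib, ← hself, Finset.sum_const, sub_one_mul, nsmul_eq_mul]
    rfl

open scoped Classical in
/-- If nothing enters or leaves the root, but some edge is left, then the indicator function of the
vertices met by `E` is in the kernel of the Laplacian. -/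
lemma det_reducedLaplacian_eq_zero (s t : ε → V) {r : V} {E : Finset ε}
    (h : TrailBalanced s t r r E) (hr : outDeg s E r = 0) (hE : E.Nonempty) : (reducedLaplacian s t r E).det = 0 := by
  classical
  obtain ⟨e₀, he₀⟩ := hE
  have hbal : ∀ v, outDeg s E v = outDeg t E v := fun v => by have := h v; omega
  have hpos : ∀ (f : ε → V), ∀ e ∈ E, outDeg f E (f e) ≠ 0 := by
    intro f e he h0
    rw [outDeg, Finset.card_eq_zero, Finset.filter_eq_empty_iff] at h0
    exact h0 he rfl
  have hs : ∀ e ∈ E, s e ≠ r := fun e he hh => hpos s e he (by rw [hh, hr])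
  rw [← Matrix.exists_mulVec_eq_zero_iff]
  refine ⟨fun v => if outDeg s E v = 0 then 0 else 1, ?_, ?_⟩
  · intro h0
    have := congrFun h0 ⟨s e₀, hs e₀ he₀⟩
    simp [hpos s e₀ he₀] at this
  · ext v
    rw [Matrix.mulVec, dotProduct, Pi.zero_apply]
    unfold reducedLaplacian
    by_cases hv : outDeg s E v = 0
    · simp only [if_pos hv]
      refine Finset.sum_eq_zero fun w _ => ?_
      by_cases hvw : v = w
      · subst hvw
        rw [if_pos hv, mul_zero]
      · rw [if_neg hvw, zero_mul]
    · simp only [if_neg hv]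
      simp only [Finset.sum_mul]
      rw [Finset.sum_comm]
      refine Finset.sum_eq_zero fun e he => ?_
      have he := (Finset.mem_filter.1 he).1
      have ht : outDeg s E (t e) ≠ 0 := by rw [hbal]; exact hpos t e he
      have htr : t e ≠ r := fun hh => ht (by rw [hh, hr])
      have hw : ∀ w : {v // v ≠ r}, (t e = w) = ((⟨t e, htr⟩ : {v // v ≠ r}) = w) := fun w => by
        rw [Subtype.ext_iff]
      simp only [sub_mul, Finset.sum_sub_distrib, ite_mul, one_mul, zero_mul, hw,
        Finset.sum_ite_eq, Finset.mem_univ, if_true, if_neg hv, if_neg ht, sub_self]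

open scoped Classical in
/-- The BEST theorem for trails, with the matrix-tree theorem built in: the number of Eulerian
trails from `u` to `r` is the number of orderings of the exits times the determinant of the
reduced Laplacian. The proof is by induction on the number of edges, removing the first one. -/
theorem trailCount_eq_det [Fintype ε] (s t : ε → V) (r : V) (k : ℕ) (u : V) (E : Finset ε)
    (hk : E.card = k) (h : TrailBalanced s t r u E) :
    trailCount s t r k u E = exitOrders s r E * (reducedLaplacian s t r E).det := by
  classical
  induction k generalizing u E with
  | zero =>
    rw [Finset.card_eq_zero] at hk
    subst hk
    have hur : u = r := by
      have := h u
      by_contra hne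
      simp [outDeg, hne] at this
    have hlap : reducedLaplacian s t r ∅ = 1 := by
      ext v w
      simp [reducedLaplacian, outDeg, Matrix.one_apply]
    rw [hlap]
    simp [trailCount, IsTrail, hur, exitOrders, outDeg, Function.injective_of_subsingleton]
  | succ k ih =>
    rw [trailCount_succ, Finset.sum_congr rfl fun e he => ih (t e) (E.erase e)
      (by rw [Finset.card_erase_of_mem (Finset.mem_filter.1 he).1, hk]; rfl)
      (h.erase (Finset.mem_filter.1 he).1 (Finset.mem_filter.1 he).2)]
    by_cases hur : u = r
    · subst hur
      by_cases h0 : outDeg s E u = 0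
      · rw [det_reducedLaplacian_eq_zero s t h h0 (Finset.card_pos.1 (by omega)), mul_zero]
        rw [outDeg, Finset.card_eq_zero] at h0
        rw [h0, Finset.sum_empty]
      · have h0' : (outDeg s E u : ℤ) ≠ 0 := by exact_mod_cast h0
        refine mul_left_cancel₀ h0' ?_
        rw [Finset.mul_sum, Finset.sum_congr rfl fun e he => by
          rw [← mul_assoc, exitOrders_erase_root s u (Finset.mem_filter.1 he).1
            (Finset.mem_filter.1 he).2,
            reducedLaplacian_erase_root s t u (Finset.mem_filter.1 he).2]]
        rw [Finset.sum_const, nsmul_eq_mul]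
        rfl
    · have hc : (if outDeg s E u = 1 then 1 else ((outDeg s E u : ℤ) - 1)) ≠ 0 := by
        have := h u
        split_ifs with h1
        · exact one_ne_zero
        · rw [if_neg hur, if_pos rfl] at this
          omega
      refine mul_left_cancel₀ hc ?_
      rw [Finset.mul_sum, Finset.sum_congr rfl fun e he => by
        rw [← mul_assoc, ← exitOrders_erase s (Finset.mem_filter.1 he).1 ⟨u, hur⟩
          (Finset.mem_filter.1 he).2]]
      rw [← Finset.mul_sum, sum_det_reducedLaplacian_erase s t ⟨u, hur⟩ h]
      ring

end Trails

/-! ### Laplacians of coloured chords -/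

section Colourings

variable {V H R : Type*}

/-- Summing over all colourings `c : H → V`, weighted by the monomial of the colours, a product of
functions of the colours of distinct points: the points are independent. -/
lemma sum_prod_weight_mul_prod [Fintype V] [Fintype H] [DecidableEq H] [CommRing R] {Y : Type*}
    [Fintype Y] [DecidableEq Y] (x : V → R) {J : Y → H} (hJ : Function.Injective J) (g : Y → V → R) :
    ∑ c : H → V, (∏ i, x (c i)) * ∏ y, g y (c (J y)) =
      (∏ y, ∑ w, x w * g y w) * (∑ w, x w) ^ (Fintype.card H - Fintype.card Y) := by
  have h1 : ∀ c : H → V, (∏ i, x (c i)) * ∏ y, g y (c (J y)) =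
      ∏ i, (x (c i) * ∏ y, if J y = i then g y (c i) else 1) := by
    intro c
    rw [Finset.prod_mul_distrib, Finset.prod_comm]
    simp
  have h2 := Finset.prod_univ_sum (R := R) (fun _ : H => (Finset.univ : Finset V))
    (fun i w => x w * ∏ y, if J y = i then g y w else 1)
  rw [Fintype.piFinset_univ] at h2
  rw [Finset.sum_congr rfl fun c _ => h1 c, ← h2,
    ← Finset.prod_mul_prod_compl (Finset.univ.image J), Finset.prod_image hJ.injOn]
  congr 1
  · refine Finset.prod_congr rfl fun y _ => Finset.sum_congr rfl fun w _ => ?_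
    simp [hJ.eq_iff]
  · rw [← Finset.card_univ (α := Y), ← Finset.card_image_of_injective Finset.univ hJ,
      ← Finset.card_compl, ← Finset.prod_const]
    refine Finset.prod_congr rfl fun i hi => Finset.sum_congr rfl fun w _ => ?_
    rw [Finset.prod_eq_one, mul_one]
    intro y _
    rw [if_neg]
    rintro rfl
    simp at hi

/-- The Laplacian of the graph with the chords of `ι` as edges and the colours of their ends as
vertices, with the row and the column of the root `r` deleted. The row of an unused colour is
zero. -/
def colourLaplacian [Fintype H] [DecidableEq V] (ι : H → H) (r : V) (c : H → V) :
    Matrix {v // v ≠ r} {v // v ≠ r} ℤ :=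
  fun v w => ∑ a, if c a = v then (if v = w then 1 else 0) - (if c (ι a) = w then 1 else 0) else 0

/-- The Laplacian whose row `v` only takes the edge from the point `φ v` into account. -/
def pickMatrix [DecidableEq V] (ι : H → H) (r : V) (φ : {v // v ≠ r} → H) (c : H → V) :
    Matrix {v // v ≠ r} {v // v ≠ r} ℤ :=
  fun v w =>
    if c (φ v) = v then (if v = w then 1 else 0) - (if c (ι (φ v)) = w then 1 else 0) else 0

lemma det_colourLaplacian [Fintype V] [Fintype H] [DecidableEq V] (ι : H → H) (r : V) (c : H → V) :
    (colourLaplacian ι r c).det = ∑ φ : {v // v ≠ r} → H, (pickMatrix ι r φ c).det := by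
  have := (Matrix.detRowAlternating (n := {v // v ≠ r}) (R := ℤ)).toMultilinearMap.map_sum
    (fun (v : {v // v ≠ r}) (a : H) (w : {v // v ≠ r}) => (if c a = v then
      (if v = w then 1 else 0) - (if c (ι a) = w then 1 else 0) else 0 : ℤ))
  refine Eq.trans (congrArg Matrix.det ?_) this
  ext v w
  rw [Finset.sum_apply]
  rfl

/-- The points `φ v` lie on distinct chords of `ι`. -/
def PicksChords {Y : Type*} (ι : H → H) (φ : Y → H) : Prop :=
  Function.Injective (Sum.elim φ (ι ∘ φ))

lemma picksChords_iff {Y : Type*} {ι : H → H} (hι : ∀ a, ι (ι a) = a ∧ ι a ≠ a) (φ : Y → H) :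
    PicksChords ι φ ↔ ∀ v w, v ≠ w → φ v ≠ φ w ∧ φ v ≠ ι (φ w) := by
  constructor
  · intro h v w hvw
    refine ⟨fun he => hvw (Sum.inl.inj (h (a₁ := Sum.inl v) (a₂ := Sum.inl w) he)), fun he => ?_⟩
    exact Sum.inl_ne_inr (h (a₁ := Sum.inl v) (a₂ := Sum.inr w) he)
  · intro h
    have h1 : Function.Injective φ := fun v w hvw => by
      by_contra hne
      exact (h v w hne).1 hvw
    refine h1.sumElim ?_ ?_
    · intro v w hvw
      refine h1 ?_
      rw [← (hι (φ v)).1, ← (hι (φ w)).1]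
      exact congrArg ι hvw
    · intro v w
      by_cases hvw : v = w
      · subst hvw
        exact (hι (φ v)).2.symm
      · exact (h v w hvw).2

/-- Two rows that pick the same point cannot both be nonzero, and two rows that pick the two ends
of one chord are opposite. -/
lemma det_pickMatrix_eq_zero [Fintype V] [DecidableEq V] {ι : H → H}
    (hι : ∀ a, ι (ι a) = a ∧ ι a ≠ a) (r : V) {φ : {v // v ≠ r} → H} (hφ : ¬PicksChords ι φ) (c : H → V) : (pickMatrix ι r φ c).det = 0 := by
  rw [picksChords_iff hι] at hφ
  push Not at hφ
  obtain ⟨v, w, hvw, h⟩ := hφ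
  by_cases hv : c (φ v) = v
  swap
  · exact Matrix.det_eq_zero_of_row_eq_zero v fun u => if_neg hv
  by_cases hw : c (φ w) = w
  swap
  · exact Matrix.det_eq_zero_of_row_eq_zero w fun u => if_neg hw
  have hne : φ v ≠ φ w := fun he => hvw (Subtype.ext (by rw [← hv, ← hw, he]))
  have h' := h hne
  rw [← Matrix.det_updateRow_add_self _ hvw]
  refine Matrix.det_eq_zero_of_row_eq_zero v fun u => ?_
  rw [Matrix.updateRow_self, Pi.add_apply]
  unfold pickMatrix
  rw [if_pos hv, if_pos hw, ← h', hv, h', (hι _).1, hw]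
  simp only [← Subtype.ext_iff]
  ring

/-- The end `φ v` of a picked chord must have the colour `v`, its other end has any colour, and the
remaining points are free. Summing each row over the colour of the other end leaves a scalar matrix
minus a matrix of rank one. -/
lemma sum_weight_mul_det_pickMatrix [Fintype V] [Fintype H] [DecidableEq V] [DecidableEq H]
    [CommRing R] (ι : H → H) (r : V) {φ : {v // v ≠ r} → H}
    (hφ : PicksChords ι φ) (x : V → R) :
    ∑ c : H → V, (∏ i, x (c i)) * ((pickMatrix ι r φ c).det : R) =
      (∏ v : {v // v ≠ r}, x v) *
        (Matrix.of fun v w : {v // v ≠ r} => (if v = w then ∑ u, x u else 0) - x w).det *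
        (∑ u, x u) ^ (Fintype.card H - 2 * Fintype.card {v // v ≠ r}) := by
  have hdet : ∀ c : H → V, ((pickMatrix ι r φ c).det : R) =
      ∑ σ : Equiv.Perm {v // v ≠ r}, (Equiv.Perm.sign σ : R) * ∏ y : {v // v ≠ r} ⊕ {v // v ≠ r},
        (Sum.elim (fun v a => if a = v.1 then 1 else 0)
          (fun v a => (if v = σ v then 1 else 0) - (if a = (σ v).1 then 1 else 0)) y : V → R)
          (c (Sum.elim φ (ι ∘ φ) y)) := by
    intro c
    rw [← Matrix.det_transpose, Matrix.det_apply']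
    push_cast
    refine Finset.sum_congr rfl fun σ _ => ?_
    rw [Fintype.prod_sum_type, ← Finset.prod_mul_distrib]
    congr 1
    refine Finset.prod_congr rfl fun v _ => ?_
    rw [Matrix.transpose_apply]
    unfold pickMatrix
    simp only [Sum.elim_inl, Sum.elim_inr, Function.comp_apply]
    split_ifs <;> simp
  simp only [hdet, Finset.mul_sum]
  rw [Finset.sum_comm, ← Matrix.det_transpose, Matrix.det_apply', Finset.mul_sum, Finset.sum_mul]
  refine Finset.sum_congr rfl fun σ _ => ?_
  have := sum_prod_weight_mul_prod x hφ (Sum.elim (fun v a => if a = v.1 then 1 else 0)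
          (fun v a => (if v = σ v then 1 else 0) - (if a = (σ v).1 then 1 else 0)))
  simp only [mul_left_comm _ (((Equiv.Perm.sign σ : ℤ) : R))]
  rw [← Finset.mul_sum, this, Fintype.prod_sum_type, Fintype.card_sum, ← two_mul]
  simp only [Sum.elim_inl, Sum.elim_inr, mul_sub, Finset.sum_sub_distrib, mul_ite, mul_one,
    mul_zero, Finset.sum_ite_eq', Finset.mem_univ, if_true, Matrix.transpose_apply, Matrix.of_apply]
  have hs : ∀ v, (∑ w, if v = σ v then x w else 0) = if v = σ v then ∑ w, x w else 0 := by
    intro v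
    split_ifs <;> simp
  simp only [hs]
  ring

/-- The determinant of a scalar matrix minus a matrix of rank one. -/
lemma sum_mul_det_sub [Fintype V] [DecidableEq V] [CommRing R] (r : V) (x : V → R) :
    (∑ u, x u) * (Matrix.of fun v w : {v // v ≠ r} => (if v = w then ∑ u, x u else 0) - x w).det =
      (∑ u, x u) ^ Fintype.card {v // v ≠ r} * x r := by
  have h1 : (Matrix.of fun v w : {v // v ≠ r} => (if v = w then ∑ u, x u else 0) - x w) =
      Matrix.scalar {v // v ≠ r} (∑ u, x u) -
        Matrix.vecMulVec (fun _ => 1) (fun w : {v // v ≠ r} => x w) := by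
    ext v w
    rw [Matrix.sub_apply, Matrix.scalar_apply, Matrix.diagonal_apply, Matrix.vecMulVec_apply,
      one_mul, Matrix.of_apply]
  have hsum : ∑ u, x u = x r + ∑ w : {v // v ≠ r}, x w := by
    rw [← Finset.add_sum_erase _ _ (Finset.mem_univ r)]
    congr 1
    refine (Finset.sum_subtype (Finset.univ.erase r) (fun v => ?_) x)
    simp
  rw [h1, ← Matrix.eval_charpoly, Matrix.charpoly_vecMulVec]
  simp only [dotProduct, one_mul, Polynomial.eval_sub, Polynomial.eval_pow, Polynomial.eval_X,
    Polynomial.eval_smul, smul_eq_mul]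
  rcases Nat.eq_zero_or_pos (Fintype.card {v // v ≠ r}) with h0 | h0
  · have : IsEmpty {v // v ≠ r} := Fintype.card_eq_zero_iff.1 h0
    rw [hsum, h0]
    simp
  · obtain ⟨m, hm⟩ := Nat.exists_eq_add_of_lt h0
    rw [hm, zero_add, Nat.add_sub_cancel, pow_succ]
    linear_combination (∑ u, x u) ^ m * (∑ u, x u) * hsum

open scoped Classical in
lemma card_picksChords_fin [Fintype H] {n : ℕ} {ι : H → H} (hι : ∀ a, ι (ι a) = a ∧ ι a ≠ a)
    (hX : Fintype.card H = 2 * n) (m : ℕ) :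
    ∑ φ : Fin m → H, (if PicksChords ι φ then 1 else 0) = 2 ^ m * n.descFactorial m := by
  induction m with
  | zero => simp [PicksChords, Function.injective_of_subsingleton]
  | succ m ih =>
    have hcons : ∀ (a : H) (φ : Fin m → H), PicksChords ι (Fin.cons a φ : Fin (m + 1) → H) ↔
        PicksChords ι φ ∧ a ∈ (Finset.univ.image (Sum.elim φ (ι ∘ φ)))ᶜ := by
      intro a φ
      simp only [picksChords_iff hι, Finset.mem_compl, Finset.mem_image, Finset.mem_univ, true_and,
        Sum.exists, Sum.elim_inl, Sum.elim_inr, Function.comp_apply, not_or, not_exists]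
      constructor
      · intro h
        refine ⟨fun v w hvw => ?_, fun v hv => ?_, fun v hv => ?_⟩
        · simpa using h v.succ w.succ (by simpa using hvw)
        · exact (h v.succ 0 (Fin.succ_ne_zero v)).1 (by simpa using hv)
        · exact (h 0 v.succ (Fin.succ_ne_zero v).symm).2 (by simpa using hv.symm)
      · rintro ⟨h1, h2, h3⟩ v w hvw
        refine Fin.cases (fun hvw => ?_) (fun v hvw => ?_) v hvw <;>
        refine Fin.cases (fun hvw => ?_) (fun w hvw => ?_) w hvw
        · exact absurd rfl hvw
        · exact ⟨fun he => h2 w (by simpa using he.symm), fun he => h3 w (by simpa using he.symm)⟩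
        · refine ⟨fun he => h2 v (by simpa using he), fun he => h3 v ?_⟩
          rw [Fin.cons_succ, Fin.cons_zero] at he
          rw [he, (hι a).1]
        · simpa using h1 v w (fun he => hvw (congrArg _ he))
    rw [← (Fin.consEquiv fun _ => H).sum_comp, Fintype.sum_prod_type, Finset.sum_comm,
      Nat.descFactorial_succ]
    simp only [Fin.consEquiv, Equiv.coe_fn_mk, hcons]
    have hin : ∀ φ : Fin m → H, (∑ a : H, if PicksChords ι φ ∧
        a ∈ (Finset.univ.image (Sum.elim φ (ι ∘ φ)))ᶜ then 1 else 0) =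
        (2 * (n - m)) * if PicksChords ι φ then 1 else 0 := by
      intro φ
      by_cases h : PicksChords ι φ
      · simp only [h, true_and, if_true]
        rw [Finset.sum_boole, Finset.filter_mem_eq_inter, Finset.univ_inter, Finset.card_compl,
          Finset.card_image_of_injective _ h, hX]
        simp
        omega
      · simp [h]
    rw [Finset.sum_congr rfl fun φ _ => hin φ, ← Finset.mul_sum, ih]
    ring

end Colourings

/-! ### Sums over all colourings -/

section Moments

open MvPolynomial

variable {V H R : Type*}

open scoped Classical in
lemma card_picksChords {Y : Type*} [Fintype Y] [DecidableEq Y] [Fintype H] {n : ℕ} {ι : H → H}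
    (hι : ∀ a, ι (ι a) = a ∧ ι a ≠ a) (hX : Fintype.card H = 2 * n) :
    ∑ φ : Y → H, (if PicksChords ι φ then 1 else 0) =
      2 ^ Fintype.card Y * n.descFactorial (Fintype.card Y) := by
  rw [← card_picksChords_fin hι hX (Fintype.card Y),
    ← ((Fintype.equivFin Y).arrowCongr (Equiv.refl H)).symm.sum_comp]
  refine Finset.sum_congr rfl fun φ _ => ?_
  have : PicksChords ι (((Fintype.equivFin Y).arrowCongr (Equiv.refl H)).symm φ) ↔
      PicksChords ι φ := by
    unfold PicksChords
    have h : Sum.elim (((Fintype.equivFin Y).arrowCongr (Equiv.refl H)).symm φ)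
        (ι ∘ ((Fintype.equivFin Y).arrowCongr (Equiv.refl H)).symm φ) =
        Sum.elim φ (ι ∘ φ) ∘ Equiv.sumCongr (Fintype.equivFin Y) (Fintype.equivFin Y) := by
      ext y
      rcases y with y | y <;> simp [Equiv.arrowCongr]
    rw [h, Equiv.injective_comp]
  rw [if_congr this rfl rfl]

/-- The reduced determinants of all coloured chord diagrams on the points `X`, summed with the
monomials of the colours. Each way to pick chords for the rows contributes the same amount. -/
theorem sum_weight_mul_det_colourLaplacian [Fintype V] [DecidableEq V] [Fintype H]
    [DecidableEq H] [CommRing R] {n : ℕ}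
    {ι : H → H} (hι : ∀ a, ι (ι a) = a ∧ ι a ≠ a) (hX : Fintype.card H = 2 * n) (r : V)
    (x : V → R) :
    (∑ u, x u) * ∑ c : H → V, (∏ i, x (c i)) * ((colourLaplacian ι r c).det : R) =
      ((2 ^ Fintype.card {v // v ≠ r} * n.descFactorial (Fintype.card {v // v ≠ r}) : ℕ) : R) *
        (∏ v, x v) * (∑ u, x u) ^ (2 * n - Fintype.card {v // v ≠ r}) := by
  classical
  have hprod : ∏ v, x v = x r * ∏ v : {v // v ≠ r}, x v := by
    rw [← Finset.mul_prod_erase _ _ (Finset.mem_univ r)]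
    congr 1
    refine Finset.prod_subtype (Finset.univ.erase r) (fun v => ?_) x
    simp
  have hterm : ∀ φ : {v // v ≠ r} → H,
      (∑ u, x u) * ∑ c : H → V, (∏ i, x (c i)) * ((pickMatrix ι r φ c).det : R) =
      (if PicksChords ι φ then 1 else 0 : ℕ) *
        ((∏ v, x v) * (∑ u, x u) ^ (2 * n - Fintype.card {v // v ≠ r})) := by
    intro φ
    split_ifs with hφ
    · have hle : 2 * Fintype.card {v // v ≠ r} ≤ 2 * n := by
        rw [← hX, two_mul, ← Fintype.card_sum]
        exact Fintype.card_le_of_injective _ hφ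
      have hexp : 2 * n - Fintype.card {v // v ≠ r} =
          Fintype.card {v // v ≠ r} + (2 * n - 2 * Fintype.card {v // v ≠ r}) := by omega
      rw [sum_weight_mul_det_pickMatrix ι r hφ x, hX, hexp, pow_add, hprod]
      have := sum_mul_det_sub r x
      push_cast
      linear_combination (∏ v : {v // v ≠ r}, x v) *
        (∑ u, x u) ^ (2 * n - 2 * Fintype.card {v // v ≠ r}) * this
    · simp [det_pickMatrix_eq_zero hι r hφ]
  simp only [det_colourLaplacian, Int.cast_sum]
  rw [Finset.sum_congr rfl fun (c : H → V) _ => Finset.mul_sum _ _ (∏ i, x (c i))]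
  rw [Finset.sum_comm, Finset.mul_sum, Finset.sum_congr rfl fun φ _ => hterm φ, ← Finset.sum_mul,
    ← Nat.cast_sum, card_picksChords hι hX]
  ring

/-- The linear functional on polynomials that sends the monomial with exponents `d` to `w d`. -/
noncomputable def monomialFunctional (w : (V →₀ ℕ) → ℤ) : MvPolynomial V ℤ →ₗ[ℤ] ℤ :=
  (basisMonomials V ℤ).constr ℤ w

@[simp] lemma monomialFunctional_monomial (w : (V →₀ ℕ) → ℤ) (d : V →₀ ℕ) (a : ℤ) :
    monomialFunctional w (monomial d a) = a * w d := by
  have h : (monomial d a : MvPolynomial V ℤ) = a • basisMonomials V ℤ d := by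
    rw [coe_basisMonomials, smul_monomial, smul_eq_mul, mul_one]
  rw [h, map_smul, monomialFunctional, Module.Basis.constr_basis, smul_eq_mul]

lemma sum_eq_of_mem_support [Fintype V] {q : MvPolynomial V ℤ} {p : ℕ} (hq : q.IsHomogeneous p)
    {d : V →₀ ℕ} (hd : d ∈ q.support) : ∑ v, d v = p := by
  rw [hq.degree_eq_sum_deg_support hd]
  exact (Finset.sum_subset (Finset.subset_univ _) fun v _ hv => by simpa using hv).symm

/-- Adding a point to a colour class of size `d v` multiplies `(d v)!` by `d v + 1`; the sum of
these factors only depends on the number of points. -/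
lemma monomialFunctional_factorial_sum_X_mul [Fintype V] {q : MvPolynomial V ℤ} {p : ℕ}
    (hq : q.IsHomogeneous p) :
    monomialFunctional (fun d => ∏ v, ((d v).factorial : ℤ)) ((∑ v, X v) * q) =
      (Fintype.card V + p : ℕ) * monomialFunctional (fun d => ∏ v, ((d v).factorial : ℤ)) q := by
  classical
  rw [q.as_sum, Finset.mul_sum, map_sum, map_sum, Finset.mul_sum]
  refine Finset.sum_congr rfl fun d hd => ?_
  rw [← sum_eq_of_mem_support hq hd, Finset.sum_mul, map_sum]
  have h : ∀ v, monomialFunctional (fun d => ∏ v, ((d v).factorial : ℤ))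
      (X v * monomial d (coeff d q)) = (d v + 1) * (coeff d q * ∏ v, ((d v).factorial : ℤ)) := by
    intro v
    rw [X, monomial_mul, monomialFunctional_monomial, one_mul,
      ← Finset.mul_prod_erase _ _ (Finset.mem_univ v),
      ← Finset.mul_prod_erase _ (fun v => ((d v).factorial : ℤ)) (Finset.mem_univ v),
      Finset.prod_congr rfl fun u hu => by
        rw [Finsupp.add_apply, Finsupp.single_eq_of_ne (Finset.ne_of_mem_erase hu), zero_add]]
    rw [Finsupp.add_apply, Finsupp.single_eq_same, add_comm 1, Nat.factorial_succ]
    push_cast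
    ring
  rw [Finset.sum_congr rfl fun v _ => h v, ← Finset.sum_mul, monomialFunctional_monomial,
    Finset.sum_add_distrib, Finset.sum_const, Finset.card_univ, nsmul_one]
  push_cast
  ring

lemma isHomogeneous_sum_X [Fintype V] : (∑ v, X v : MvPolynomial V ℤ).IsHomogeneous 1 :=
  IsHomogeneous.sum _ _ _ fun v _ => isHomogeneous_X ℤ v

lemma monomialFunctional_factorial_sum_X_pow [Fintype V] (p : ℕ) :
    monomialFunctional (fun d => ∏ v, ((d v).factorial : ℤ)) ((∑ v : V, X v) ^ p) =
      (Fintype.card V).ascFactorial p := by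
  induction p with
  | zero =>
    rw [pow_zero, show (1 : MvPolynomial V ℤ) = monomial 0 1 from rfl, monomialFunctional_monomial]
    simp
  | succ p ih =>
    have := (isHomogeneous_sum_X (V := V)).pow p
    rw [one_mul] at this
    rw [pow_succ', monomialFunctional_factorial_sum_X_mul this, ih, Nat.ascFactorial_succ]
    push_cast
    ring

lemma monomialFunctional_prod_X_mul [Fintype V] {q : MvPolynomial V ℤ} {p : ℕ}
    (hq : q.IsHomogeneous p) :
    ∑ r : V, monomialFunctional (fun d => d r * ∏ v, ((d v - 1).factorial : ℤ))
        ((∏ v : V, X v) * q) =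
      (Fintype.card V + p : ℕ) * monomialFunctional (fun d => ∏ v, ((d v).factorial : ℤ)) q := by
  classical
  have hX : (∏ v : V, X v : MvPolynomial V ℤ) = monomial (∑ v, Finsupp.single v 1) 1 := by
    rw [monomial_sum_one]
    rfl
  have hone : ∀ (d : V →₀ ℕ) (u : V),
      ((∑ v, Finsupp.single v 1 : V →₀ ℕ) + d) u = d u + 1 := by
    intro d u
    rw [Finsupp.add_apply, Finsupp.finsetSum_apply]
    simp [Finsupp.single_apply, add_comm]
  rw [q.as_sum, Finset.mul_sum, map_sum, Finset.mul_sum]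
  simp only [map_sum]
  rw [Finset.sum_comm]
  refine Finset.sum_congr rfl fun d hd => ?_
  rw [← sum_eq_of_mem_support hq hd]
  simp only [hX, monomial_mul, monomialFunctional_monomial, hone, one_mul, Nat.add_sub_cancel]
  rw [← Finset.mul_sum, ← Finset.sum_mul]
  push_cast
  rw [Finset.sum_add_distrib, Finset.sum_const, Finset.card_univ, nsmul_one]
  ring

open scoped Classical in
/-- The total number of closed Eulerian trails, over all surjective colourings of the ends of a
fixed set of chords: a closed trail passes the chords in both directions. -/
theorem sum_trailCount [Fintype V] [Nonempty V] [Fintype H] [DecidableEq H] {n : ℕ} (hn : n ≠ 0)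
    {ι : H → H} (hι : ∀ a, ι (ι a) = a ∧ ι a ≠ a) (hX : Fintype.card H = 2 * n) :
    ∑ c : H → V, (if Function.Surjective c then
        ∑ r, trailCount c (c ∘ ι) r (2 * n) r Finset.univ else 0) =
      ((2 * n).factorial * (2 ^ (Fintype.card V - 1) * n.choose (Fintype.card V - 1)) : ℕ) := by
  classical
  obtain ⟨m, hm⟩ := Nat.exists_eq_add_of_lt (Fintype.card_pos (α := V))
  rw [zero_add] at hm
  have hcard : ∀ r : V, Fintype.card {v // v ≠ r} = m := by
    intro r
    rw [Fintype.card_subtype_compl, Fintype.card_subtype_eq, hm, Nat.add_sub_cancel]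
  -- The exponent vector of the monomial of a colouring consists of the out-degrees.
  have hdeg : ∀ (c : H → V), (∏ i, X (R := ℤ) (c i)) =
      monomial (∑ i, Finsupp.single (c i) 1) 1 := by
    intro c
    rw [monomial_sum_one]
    rfl
  have hdeg' : ∀ (c : H → V) (v : V), (∑ i, Finsupp.single (c i) 1 : V →₀ ℕ) v =
      outDeg c Finset.univ v := by
    intro c v
    rw [Finsupp.finsetSum_apply, outDeg, Finset.card_filter]
    exact Finset.sum_congr rfl fun i _ => by rw [Finsupp.single_apply]
  have hpos : ∀ (c : H → V) (v : V), outDeg c Finset.univ v = 0 ↔ ∀ a, c a ≠ v := by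
    intro c v
    rw [outDeg, Finset.card_eq_zero, Finset.filter_eq_empty_iff]
    simp
  have htrail : ∀ (c : H → V) (r : V),
      monomialFunctional (fun d => d r * ∏ v, ((d v - 1).factorial : ℤ))
        ((∏ i, X (c i)) * ((colourLaplacian ι r c).det : MvPolynomial V ℤ)) =
      if Function.Surjective c then trailCount c (c ∘ ι) r (2 * n) r Finset.univ else 0 := by
    intro c r
    have hC : ((colourLaplacian ι r c).det : MvPolynomial V ℤ) =
        monomial 0 (colourLaplacian ι r c).det := (eq_intCast C _).symm
    rw [hdeg, hC, monomial_mul, monomialFunctional_monomial, add_zero, one_mul]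
    simp only [hdeg']
    split_ifs with hc
    · have hne : ∀ v, outDeg c Finset.univ v ≠ 0 := fun v h0 => by
        obtain ⟨a, ha⟩ := hc v
        exact (hpos c v).1 h0 a ha
      rw [trailCount_eq_det c (c ∘ ι) r (2 * n) r Finset.univ (by rw [Finset.card_univ, hX])]
      · have h1 : reducedLaplacian c (c ∘ ι) r Finset.univ = colourLaplacian ι r c := by
          ext v w
          unfold reducedLaplacian colourLaplacian
          rw [if_neg (hne v), Finset.sum_filter]
          simp only [Subtype.ext_iff, Function.comp_apply]
        have h2 : exitOrders c r Finset.univ =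
            outDeg c Finset.univ r * ∏ v, ((outDeg c Finset.univ v - 1).factorial : ℤ) := by
          unfold exitOrders
          rw [← Finset.mul_prod_erase _ _ (Finset.mem_univ r), ← mul_assoc]
          congr 1
          · rw [← Nat.mul_factorial_pred (hne r)]
            push_cast
            rfl
          · refine (Finset.prod_subtype (Finset.univ.erase r) (fun v => ?_)
              fun v => ((outDeg c Finset.univ v - 1).factorial : ℤ)).symm
            simp
        rw [h1, h2, mul_comm]
      · -- Every chord is passed in both directions, so in-degrees and out-degrees agree.
        intro v
        congr 1
        unfold outDeg
        refine Finset.card_bij (fun a _ => ι a) ?_ ?_ ?_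
        · intro a ha
          simpa [(hι a).1] using ha
        · intro a _ b _ hab
          rw [← (hι a).1, hab, (hι b).1]
        · intro b hb
          exact ⟨ι b, by simpa using hb, (hι b).1⟩
    · -- Either the root is unused and the out-degree of `r` is zero, or a row is zero.
      rw [Function.Surjective] at hc
      push Not at hc
      obtain ⟨v, hv⟩ := hc
      by_cases hvr : v = r
      · rw [← hvr, (hpos c v).2 hv]
        simp
      · rw [Matrix.det_eq_zero_of_row_eq_zero ⟨v, hvr⟩ fun w => ?_, zero_mul]
        exact Finset.sum_eq_zero fun a _ => if_neg (hv a)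
  have hpoly : ∀ r : V, ∑ c : H → V, (∏ i, X (c i)) *
      ((colourLaplacian ι r c).det : MvPolynomial V ℤ) =
      ((2 ^ m * n.descFactorial m : ℕ) : MvPolynomial V ℤ) * ((∏ v, X v) *
        (∑ u, X u) ^ (2 * n - m - 1)) := by
    intro r
    -- The closed form is only known after multiplication by the sum of the variables.
    have h0 : (∑ u : V, X u : MvPolynomial V ℤ) ≠ 0 := by
      intro h
      have h1 := congrArg (MvPolynomial.eval fun u => if u = r then (1 : ℤ) else 0) h
      simp at h1
    refine mul_left_cancel₀ h0 ?_
    rw [sum_weight_mul_det_colourLaplacian hι hX, hcard]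
    rcases lt_or_ge n m with hnm | hnm
    · rw [Nat.descFactorial_of_lt hnm]
      simp
    · obtain ⟨k, hk⟩ := Nat.exists_eq_add_of_lt (show 0 < 2 * n - m by omega)
      rw [hk, zero_add, Nat.add_sub_cancel, pow_succ]
      ring
  have hsum : ∑ c : H → V, (if Function.Surjective c then
        ∑ r, trailCount c (c ∘ ι) r (2 * n) r Finset.univ else 0) =
      ∑ r, monomialFunctional (fun d => d r * ∏ v, ((d v - 1).factorial : ℤ))
        (((2 ^ m * n.descFactorial m : ℕ) : MvPolynomial V ℤ) * ((∏ v, X v) *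
        (∑ u, X u) ^ (2 * n - m - 1))) := by
    have h1 : ∀ r, monomialFunctional (fun d => d r * ∏ v, ((d v - 1).factorial : ℤ))
        (((2 ^ m * n.descFactorial m : ℕ) : MvPolynomial V ℤ) * ((∏ v, X v) *
        (∑ u, X u) ^ (2 * n - m - 1))) = ∑ c : H → V,
        if Function.Surjective c then trailCount c (c ∘ ι) r (2 * n) r Finset.univ else 0 := by
      intro r
      rw [← hpoly r, map_sum]
      exact Finset.sum_congr rfl fun c _ => htrail c r
    rw [Finset.sum_congr rfl fun r _ => h1 r, Finset.sum_comm]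
    refine Finset.sum_congr rfl fun c _ => ?_
    split_ifs <;> simp
  have hhom : ((∑ v : V, X v : MvPolynomial V ℤ) ^ (2 * n - m - 1)).IsHomogeneous
      (2 * n - m - 1) := by
    have := (isHomogeneous_sum_X (V := V)).pow (2 * n - m - 1)
    rwa [one_mul] at this
  rw [hsum]
  simp only [← nsmul_eq_mul (_ : ℕ) (_ : MvPolynomial V ℤ), map_nsmul]
  rw [← Finset.smul_sum, monomialFunctional_prod_X_mul hhom,
    monomialFunctional_factorial_sum_X_pow, hm, Nat.add_sub_cancel, nsmul_eq_mul]
  rcases lt_or_ge n m with hnm | hnm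
  · rw [Nat.descFactorial_of_lt hnm, Nat.choose_eq_zero_of_lt hnm]
    simp
  · rw [show m + 1 + (2 * n - m - 1) = 2 * n by omega, Nat.descFactorial_eq_factorial_mul_choose]
    have h1 := Nat.factorial_mul_ascFactorial m (2 * n - m - 1)
    rw [show m + (2 * n - m - 1) = 2 * n - 1 by omega] at h1
    rw [← Nat.mul_factorial_pred (show 2 * n ≠ 0 by omega), ← h1]
    push_cast
    ring

end Moments

/-! ### Closed trails and chord diagrams -/

section ClosedTrails

variable {V : Type*}

open scoped Classical in
/-- Closed Eulerian trails without a prescribed starting vertex are cyclic arrangements of the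
edges with matching ends. -/
lemma sum_trailCount_eq_card [Fintype V] {m : ℕ} (hm : m ≠ 0) (s t : Fin m → V) :
    ∑ r, trailCount s t r m r Finset.univ =
      ∑ e : Equiv.Perm (Fin m), if ∀ i, t (e i) = s (e (finRotate m i)) then 1 else 0 := by
  obtain ⟨k, rfl⟩ := Nat.exists_eq_succ_of_ne_zero hm
  have hclosed : ∀ (f : Fin (k + 1) → Fin (k + 1)) (r : V), IsTrail s t r (k + 1) f r ↔
      s (f 0) = r ∧ ∀ i, t (f i) = s (f (finRotate (k + 1) i)) := by
    intro f r
    rw [isTrail_succ_iff, Fin.forall_fin_succ' (n := k), finRotate_last]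
    refine and_congr_right fun h => ?_
    rw [h]
    refine and_congr_left fun _ => forall_congr' fun i => ?_
    rw [finRotate_apply, Fin.coeSucc_eq_succ]
  simp only [trailCount, Finset.mem_univ, forall_true_iff, true_and, hclosed]
  rw [Finset.sum_comm]
  have h1 : ∀ f : Fin (k + 1) → Fin (k + 1), (∑ r : V, if Function.Injective f ∧ s (f 0) = r ∧
      ∀ i, t (f i) = s (f (finRotate (k + 1) i)) then (1 : ℤ) else 0) =
      if Function.Injective f then
        (if ∀ i, t (f i) = s (f (finRotate (k + 1) i)) then 1 else 0) else 0 := by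
    intro f
    rw [Finset.sum_eq_single (s (f 0))]
    · simp only [true_and, ite_and]
    · intro r _ hr
      rw [if_neg]
      rintro ⟨_, h, _⟩
      exact hr h.symm
    · simp
  rw [Finset.sum_congr rfl fun f _ => h1 f, ← Finset.sum_filter, eq_comm]
  refine Finset.sum_nbij (fun e => ⇑e) ?_ ?_ ?_ ?_
  · intro e _
    simpa using e.injective
  · exact DFunLike.coe_injective.injOn
  · intro f hf
    have hf' : Function.Injective f := by simpa using hf
    exact ⟨Equiv.ofBijective f (Finite.injective_iff_bijective.1 hf'), by simp, rfl⟩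
  · intro e _
    rfl

open scoped Classical in
/-- Splitting the colourings according to the set of colours that occur. -/
lemma sum_colouring_eq_sum_surjective [Fintype V] {H : Type*} [Fintype H] [DecidableEq H]
    (F : (H → V) → ℤ) :
    ∑ c, F c = ∑ S : Finset V, ∑ c : H → S,
      if Function.Surjective c then F (fun i => c i) else 0 := by
  rw [← Finset.sum_fiberwise Finset.univ (fun c : H → V => Finset.univ.image c)]
  refine Finset.sum_congr rfl fun S _ => ?_
  rw [← Finset.sum_filter, eq_comm]
  refine Finset.sum_nbij (fun c i => (c i : V)) ?_ ?_ ?_ ?_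
  · intro c hc
    have hc : Function.Surjective c := by simpa using hc
    rw [Finset.mem_filter]
    refine ⟨Finset.mem_univ _, ?_⟩
    ext v
    rw [Finset.mem_image]
    constructor
    · rintro ⟨i, _, rfl⟩
      exact (c i).2
    · intro hv
      obtain ⟨i, hi⟩ := hc ⟨v, hv⟩
      exact ⟨i, Finset.mem_univ _, by rw [hi]⟩
  · intro c _ d _ hcd
    ext i
    exact congrFun hcd i
  · intro c hc
    have hc : Finset.univ.image c = S := by simpa using hc
    subst hc
    refine ⟨fun i => ⟨c i, Finset.mem_image_of_mem c (Finset.mem_univ i)⟩, ?_, rfl⟩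
    rw [Finset.mem_coe, Finset.mem_filter]
    refine ⟨Finset.mem_univ _, fun v => ?_⟩
    obtain ⟨i, _, hi⟩ := Finset.mem_image.1 v.2
    exact ⟨i, Subtype.ext hi⟩
  · intro c _
    rfl

/-- The Harer–Zagier polynomial, up to the number of chord diagrams: `N ↦ ∑ k, 2 ^ k C(n, k)
C(N, k + 1)`. -/
def harerZagierSum (n N : ℕ) : ℕ :=
  ∑ k ∈ Finset.range (n + 1), 2 ^ k * n.choose k * N.choose (k + 1)

lemma sum_finset_eq_harerZagierSum [Fintype V] (n : ℕ) :
    ∑ S : Finset V, (if S.card = 0 then 0 else 2 ^ (S.card - 1) * n.choose (S.card - 1)) =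
      harerZagierSum n (Fintype.card V) := by
  have h := Finset.sum_powerset_apply_card
    (fun k => if k = 0 then 0 else 2 ^ (k - 1) * n.choose (k - 1))
    (x := (Finset.univ : Finset V))
  rw [Finset.powerset_univ] at h
  rw [h, Finset.card_univ, Finset.sum_range_succ', harerZagierSum]
  simp only [if_true, smul_eq_mul, mul_zero, add_zero, Nat.add_eq_zero_iff, one_ne_zero, and_false,
    if_false, Nat.add_sub_cancel]
  have h1 : ∀ m, Fintype.card V ≤ m → ∑ k ∈ Finset.range (Fintype.card V),
      (Fintype.card V).choose (k + 1) * (2 ^ k * n.choose k) = ∑ k ∈ Finset.range m,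
      (Fintype.card V).choose (k + 1) * (2 ^ k * n.choose k) := fun m hm =>
    Finset.sum_subset (Finset.range_mono hm) fun k _ hk => by
      rw [Nat.choose_eq_zero_of_lt (by simpa [Nat.lt_succ_iff] using hk), zero_mul]
  have h2 : ∀ m, n + 1 ≤ m → ∑ k ∈ Finset.range (n + 1),
      2 ^ k * n.choose k * (Fintype.card V).choose (k + 1) = ∑ k ∈ Finset.range m,
      2 ^ k * n.choose k * (Fintype.card V).choose (k + 1) := fun m hm =>
    Finset.sum_subset (Finset.range_mono hm) fun k _ hk => by
      rw [Nat.choose_eq_zero_of_lt (n := n) (by simpa [Nat.lt_succ_iff] using hk)]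
      simp
  rw [h1 _ (le_max_left _ (n + 1)), h2 _ (le_max_right (Fintype.card V) _)]
  exact Finset.sum_congr rfl fun k _ => mul_comm _ _

open scoped Classical in
lemma sum_perm_sum_colouring [Fintype V] {n : ℕ} (hn : n ≠ 0)
    {ι : Fin (2 * n) → Fin (2 * n)} (hι : ∀ a, ι (ι a) = a ∧ ι a ≠ a) :
    ∑ c : Fin (2 * n) → V, ∑ e : Equiv.Perm (Fin (2 * n)),
      (if ∀ i, c (ι (e i)) = c (e (finRotate (2 * n) i)) then (1 : ℤ) else 0) =
      ((2 * n).factorial * harerZagierSum n (Fintype.card V) : ℕ) := by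
  rw [sum_colouring_eq_sum_surjective, ← sum_finset_eq_harerZagierSum, Finset.mul_sum,
    Nat.cast_sum]
  refine Finset.sum_congr rfl fun S _ => ?_
  split_ifs with hS
  · rw [Finset.card_eq_zero] at hS
    subst hS
    have : IsEmpty (Fin (2 * n) → (∅ : Finset V)) :=
      ⟨fun c => Finset.notMem_empty _ (c ⟨0, by omega⟩).2⟩
    rw [Finset.univ_eq_empty, Finset.sum_empty]
    simp
  · have : Nonempty S := (Finset.card_ne_zero.1 hS).to_subtype
    have h := sum_trailCount (V := S) hn hι (by rw [Fintype.card_fin])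
    rw [Fintype.card_coe] at h
    rw [← h]
    refine Finset.sum_congr rfl fun c _ => ?_
    rw [sum_trailCount_eq_card (by omega)]
    simp only [Function.comp_apply, Subtype.ext_iff]

end ClosedTrails

section ChordDiagrams

variable {V : Type*}

/-- Colourings that are constant on the cycles of a permutation. -/
lemma card_colouring_eq_pow {H : Type*} [Finite H] [Finite V] (σ : Equiv.Perm H) :
    Nat.card {c : H → V // ∀ i, c (σ i) = c i} =
      Nat.card V ^ Nat.card (Quotient (Equiv.Perm.SameCycle.setoid σ)) := by
  have : Finite (Quotient (Equiv.Perm.SameCycle.setoid σ)) := Quotient.finite _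
  rw [← Nat.card_fun]
  have hz : ∀ (c : H → V), (∀ i, c (σ i) = c i) → ∀ i j, σ.SameCycle i j → c i = c j := by
    intro c hc i j hij
    obtain ⟨k, -, -, rfl⟩ := hij.exists_pow_eq'
    clear hij
    induction k with
    | zero => rfl
    | succ k ih => rw [pow_succ', Equiv.Perm.mul_apply, hc, ih]
  refine Nat.card_congr
    { toFun := fun c => Quotient.lift c.1 (hz c.1 c.2)
      invFun := fun q => ⟨fun i => q (Quotient.mk _ i), fun i => ?_⟩
      left_inv := fun c => rfl
      right_inv := fun q => ?_ }
  · refine congrArg q (Quotient.sound ?_)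
    exact Equiv.Perm.sameCycle_apply_left.2 (Equiv.Perm.SameCycle.refl σ i)
  · ext x
    induction x using Quotient.inductionOn
    rfl

lemma ChordDiagram.card_colouring {n : ℕ} (hn : n ≠ 0) [Finite V] (C : ChordDiagram n) :
    Nat.card {c : Fin (2 * n) → V // ∀ i, c (C.1 i) = c (finRotate (2 * n) i)} =
      Nat.card V ^ C.boundaryCount := by
  rw [boundaryCount, if_neg hn, ← card_colouring_eq_pow]
  refine Nat.card_congr (Equiv.subtypeEquivRight fun c => ?_)
  constructor
  · intro h i
    have := h (C.1 i)
    rw [(C.2 i).1] at this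
    exact this.symm
  · intro h i
    have := h (C.1 i)
    rw [Equiv.Perm.mul_apply, (C.2 i).1] at this
    exact this.symm

open scoped Classical in
/-- Relabelling the points by all permutations, the coloured chord diagrams become closed Eulerian
trails along the chords of any fixed diagram. -/
theorem ChordDiagram.sum_pow_boundaryCount (n N : ℕ) :
    ∑ C : ChordDiagram n, N ^ C.boundaryCount =
      Fintype.card (ChordDiagram n) * harerZagierSum n N := by
  by_cases hn : n = 0
  · subst hn
    simp [boundaryCount, harerZagierSum]
  have hconj : ∀ (e : Equiv.Perm (Fin (2 * n))) (C : ChordDiagram n), ∀ i,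
      (e⁻¹ * C.1 * e) ((e⁻¹ * C.1 * e) i) = i ∧ (e⁻¹ * C.1 * e) i ≠ i := by
    intro e C i
    simp only [Equiv.Perm.mul_apply, Equiv.Perm.coe_inv, Equiv.apply_symm_apply, (C.2 (e i)).1,
      Equiv.symm_apply_apply, true_and]
    intro h
    rw [← Equiv.Perm.coe_inv] at h
    rw [Equiv.Perm.inv_eq_iff_eq] at h
    exact (C.2 (e i)).2 h
  let conj : Equiv.Perm (Fin (2 * n)) → ChordDiagram n ≃ ChordDiagram n := fun e =>
    { toFun := fun C => ⟨e⁻¹ * C.1 * e, hconj e C⟩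
      invFun := fun C => ⟨e * C.1 * e⁻¹, by simpa using hconj e⁻¹ C⟩
      left_inv := fun C => Subtype.ext (by simp [mul_assoc])
      right_inv := fun C => Subtype.ext (by simp [mul_assoc]) }
  let A : ChordDiagram n → ℤ := fun C => ∑ c : Fin (2 * n) → Fin N,
    if ∀ i, c (C.1 i) = c (finRotate (2 * n) i) then 1 else 0
  have hA : ∀ C, A C = ((N ^ C.boundaryCount : ℕ) : ℤ) := by
    intro C
    have := C.card_colouring (V := Fin N) hn
    rw [Nat.card_eq_fintype_card, Nat.card_eq_fintype_card, Fintype.card_fin,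
      Fintype.card_subtype] at this
    rw [← this]
    exact Finset.sum_boole _ _
  have h1 : ∀ C : ChordDiagram n, ∑ e, A (conj e C) =
      ((2 * n).factorial * harerZagierSum n N : ℕ) := by
    intro C
    have := sum_perm_sum_colouring (V := Fin N) hn C.2
    rw [Fintype.card_fin, Finset.sum_comm] at this
    rw [← this]
    refine Finset.sum_congr rfl fun e _ => ?_
    refine Fintype.sum_equiv (e.arrowCongr (Equiv.refl (Fin N))) _ _ fun c => ?_
    simp [conj, Equiv.arrowCongr]
  have h2 : ∀ e, ∑ C, A (conj e C) = ∑ C, A C := fun e => (conj e).sum_comp A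
  have h3 : ∑ C, ∑ e, A (conj e C) = ∑ e, ∑ C, A (conj e C) := Finset.sum_comm
  rw [Finset.sum_congr rfl fun C _ => h1 C, Finset.sum_congr rfl fun e _ => h2 e,
    Finset.sum_const, Finset.sum_const, Finset.card_univ, Finset.card_univ, Fintype.card_perm,
    Fintype.card_fin, Finset.sum_congr rfl fun C _ => hA C, nsmul_eq_mul, nsmul_eq_mul] at h3
  have h4 : ((2 * n).factorial : ℤ) ≠ 0 := by exact_mod_cast (2 * n).factorial_ne_zero
  have h5 : ((2 * n).factorial : ℤ) * (∑ C : ChordDiagram n, N ^ C.boundaryCount : ℕ) =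
      ((2 * n).factorial : ℤ) * (Fintype.card (ChordDiagram n) * harerZagierSum n N : ℕ) := by
    push_cast at h3 ⊢
    linear_combination -h3
  exact_mod_cast mul_left_cancel₀ h4 h5

open scoped Classical in
/-- Fixed-point free involutions are the permutations with all cycles of length two. -/
lemma ChordDiagram.card_mul (n : ℕ) :
    Fintype.card (ChordDiagram n) * (2 ^ n * n.factorial) = (2 * n).factorial := by
  have h := Equiv.Perm.card_of_cycleType_mul_eq (Fin (2 * n)) (Multiset.replicate n 2)
  have hiff : ∀ σ : Equiv.Perm (Fin (2 * n)),
      σ.cycleType = Multiset.replicate n 2 ↔ ∀ i, σ (σ i) = i ∧ σ i ≠ i := by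
    intro σ
    constructor
    · intro hσ
      have hsupp : σ.support = Finset.univ := by
        rw [← Finset.card_eq_iff_eq_univ, ← Equiv.Perm.sum_cycleType, hσ]
        simp [mul_comm]
      have hsq : σ ^ 2 = 1 := by
        rw [← orderOf_dvd_iff_pow_eq_one, ← Equiv.Perm.lcm_cycleType, hσ, Multiset.lcm_dvd]
        intro b hb
        rw [Multiset.eq_of_mem_replicate hb]
      intro i
      refine ⟨?_, Equiv.Perm.mem_support.1 (hsupp ▸ Finset.mem_univ i)⟩
      have := congrArg (fun ρ : Equiv.Perm (Fin (2 * n)) => ρ i) hsq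
      simpa [pow_two] using this
    · intro hσ
      have hsq : σ ^ 2 = 1 := by
        ext i
        simp [pow_two, (hσ i).1]
      have hsupp : σ.support = Finset.univ := by
        ext i
        simp [(hσ i).2]
      have htwo : ∀ b ∈ σ.cycleType, b = 2 := by
        intro b hb
        have h1 := Equiv.Perm.two_le_of_mem_cycleType hb
        have h2 := (Equiv.Perm.dvd_of_mem_cycleType hb).trans (orderOf_dvd_of_pow_eq_one hsq)
        have := Nat.le_of_dvd (by norm_num) h2
        omega
      have hrep := Multiset.eq_replicate_card.2 htwo
      have hsum := σ.sum_cycleType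
      rw [hsupp, Finset.card_univ, Fintype.card_fin, hrep, Multiset.sum_replicate,
        smul_eq_mul] at hsum
      rw [hrep, show σ.cycleType.card = n by omega]
  have hset : (Finset.univ.filter fun σ : Equiv.Perm (Fin (2 * n)) =>
      σ.cycleType = Multiset.replicate n 2).card = Fintype.card (ChordDiagram n) := by
    rw [Fintype.card_subtype]
    exact congrArg Finset.card (Finset.filter_congr fun σ _ => hiff σ)
  rw [← hset]
  rw [Multiset.sum_replicate, Multiset.prod_replicate, smul_eq_mul, mul_comm n 2, Fintype.card_fin,
    Nat.sub_self, Nat.factorial_zero, one_mul, if_pos ⟨le_rfl, fun a ha => by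
      rw [Multiset.eq_of_mem_replicate ha]⟩] at h
  rw [← h]
  congr 2
  rcases Nat.eq_zero_or_pos n with rfl | hn
  · simp
  · rw [Multiset.toFinset_replicate, if_neg hn.ne']
    simp

open scoped Classical in
lemma ChordDiagram.card_succ (n : ℕ) :
    Fintype.card (ChordDiagram (n + 1)) = (2 * n + 1) * Fintype.card (ChordDiagram n) := by
  have h1 := card_mul n
  have h2 := card_mul (n + 1)
  have h3 : (2 * (n + 1)).factorial = (2 * n + 2) * ((2 * n + 1) * (2 * n).factorial) := by
    rw [show 2 * (n + 1) = 2 * n + 1 + 1 by ring, Nat.factorial_succ, Nat.factorial_succ]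
  rw [h3, ← h1, Nat.factorial_succ, pow_succ] at h2
  have h4 : 0 < (2 ^ n * n.factorial) * (2 * n + 2) := by positivity
  refine Nat.eq_of_mul_eq_mul_right h4 ?_
  linear_combination h2

end ChordDiagrams

/-! ### The Harer–Zagier recursion -/

section Recursion

open Polynomial

lemma harerZagierSum_rec (n N : ℕ) :
    (n + 3) * harerZagierSum (n + 2) N =
      2 * N * harerZagierSum (n + 1) N + (n + 1) * harerZagierSum n N := by
  -- All sums can be extended to the same range, with one term to spare for the shift by `N`.
  have hext : ∀ m, m ≤ n + 2 → harerZagierSum m N =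
      ∑ k ∈ Finset.range (n + 4), 2 ^ k * m.choose k * N.choose (k + 1) := fun m hm =>
    Finset.sum_subset (Finset.range_mono (by omega)) fun k _ hk => by
      rw [Nat.choose_eq_zero_of_lt (n := m) (by simpa [Nat.lt_succ_iff] using hk)]
      simp
  have hN : ∀ k, N * N.choose (k + 1) =
      (k + 2) * N.choose (k + 2) + (k + 1) * N.choose (k + 1) := by
    intro k
    have h1 := Nat.choose_succ_right_eq N (k + 1)
    rcases le_or_gt (k + 1) N with h | h
    · obtain ⟨d, rfl⟩ := Nat.exists_eq_add_of_le h
      rw [Nat.add_sub_cancel_left] at h1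
      linear_combination -h1
    · rw [Nat.choose_eq_zero_of_lt h, Nat.choose_eq_zero_of_lt (by omega : N < k + 2)]
      simp
  have hshift : N * harerZagierSum (n + 1) N = ∑ k ∈ Finset.range (n + 4),
      (k + 1) * (2 ^ (k - 1) * (if k = 0 then 0 else (n + 1).choose (k - 1)) +
        2 ^ k * (n + 1).choose k) * N.choose (k + 1) := by
    have h1 : N * harerZagierSum (n + 1) N = ∑ k ∈ Finset.range (n + 3),
        2 ^ k * (n + 1).choose k * ((k + 2) * N.choose (k + 2)) +
        ∑ k ∈ Finset.range (n + 4), 2 ^ k * (n + 1).choose k * ((k + 1) * N.choose (k + 1)) := by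
      rw [hext (n + 1) (by omega), Finset.mul_sum, Finset.sum_range_succ (n := n + 3),
        Finset.sum_range_succ (n := n + 3), Nat.choose_eq_zero_of_lt (by omega : n + 1 < n + 3),
        mul_zero, zero_mul, zero_mul, mul_zero, add_zero, add_zero, ← Finset.sum_add_distrib]
      refine Finset.sum_congr rfl fun k _ => ?_
      rw [← mul_add, ← hN]
      ring
    rw [h1, Finset.sum_range_succ' (n := n + 3), Finset.sum_range_succ' (n := n + 3), ← add_assoc,
      ← Finset.sum_add_distrib]
    congr 1
    · refine Finset.sum_congr rfl fun k _ => ?_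
      rw [if_neg (Nat.succ_ne_zero k), Nat.add_sub_cancel]
      ring
    · simp
  rw [mul_assoc 2, hshift, hext (n + 2) le_rfl, hext n (by omega), Finset.mul_sum, Finset.mul_sum,
    Finset.mul_sum, ← Finset.sum_add_distrib]
  refine Finset.sum_congr rfl fun k _ => ?_
  have key : (n + 3) * (2 ^ k * (n + 2).choose k) =
      2 * ((k + 1) * (2 ^ (k - 1) * (if k = 0 then 0 else (n + 1).choose (k - 1)) +
        2 ^ k * (n + 1).choose k)) + (n + 1) * (2 ^ k * n.choose k) := by
    rcases k with _ | k
    · simp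
      ring
    · rw [if_neg (Nat.succ_ne_zero k), Nat.add_sub_cancel]
      have h1 : (n + 2).choose (k + 1) = (n + 1).choose k + (n + 1).choose (k + 1) :=
        Nat.choose_succ_succ _ _
      have h2 : (n + 1).choose (k + 1) = n.choose k + n.choose (k + 1) := Nat.choose_succ_succ _ _
      have h3 : (n + 1) * n.choose k = (n + 1).choose (k + 1) * (k + 1) :=
        Nat.add_one_mul_choose_eq n k
      have h4 : (n + 2) * (n + 1).choose k = (n + 2).choose (k + 1) * (k + 1) :=
        Nat.add_one_mul_choose_eq (n + 1) k
      zify at h1 h2 h3 h4 ⊢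
      rw [pow_succ]
      linear_combination 2 * 2 ^ k * ((n + k + 4) * h1 + (n + 1) * h2 + h3 + h4)
  rw [show ∀ a b c d : ℕ, a * (b * c * d) = a * (b * c) * d from fun _ _ _ _ => by ring, key]
  ring

open scoped Classical in
/-- The number of chord diagrams with `n` chords and `r` boundary components. -/
noncomputable def boundaryNumber (n r : ℕ) : ℕ :=
  (Finset.univ.filter fun C : ChordDiagram n => C.boundaryCount = r).card

open scoped Classical in
/-- The polynomial `∑ r, boundaryNumber n r * X ^ r`. -/
noncomputable def boundaryPolynomial (n : ℕ) : ℤ[X] :=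
  ∑ C : ChordDiagram n, X ^ C.boundaryCount

lemma coeff_boundaryPolynomial (n r : ℕ) : (boundaryPolynomial n).coeff r = boundaryNumber n r := by
  classical
  rw [boundaryPolynomial, finsetSum_coeff, boundaryNumber, Finset.card_filter]
  push_cast
  refine Finset.sum_congr rfl fun C _ => ?_
  rw [coeff_X_pow, if_congr eq_comm rfl rfl]

open scoped Classical in
lemma eval_boundaryPolynomial (n N : ℕ) : (boundaryPolynomial n).eval (N : ℤ) =
    Fintype.card (ChordDiagram n) * harerZagierSum n N := by
  rw [boundaryPolynomial, eval_finsetSum]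
  simp only [eval_pow, eval_X]
  exact_mod_cast ChordDiagram.sum_pow_boundaryCount n N

lemma Polynomial.eq_of_forall_eval_natCast {p q : ℤ[X]}
    (h : ∀ N : ℕ, p.eval (N : ℤ) = q.eval (N : ℤ)) :
    p = q :=
  eq_of_infinite_eval_eq p q <|
    (Set.infinite_range_of_injective (Nat.cast_injective (R := ℤ))).mono <| by
      rintro _ ⟨N, rfl⟩
      exact h N

lemma boundaryPolynomial_zero : boundaryPolynomial 0 = X := by
  classical
  refine eq_of_forall_eval_natCast fun N => ?_
  have : Fintype.card (ChordDiagram 0) = 1 := by simpa using ChordDiagram.card_mul 0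
  rw [eval_boundaryPolynomial, this, eval_X]
  simp [harerZagierSum]

lemma boundaryPolynomial_one : boundaryPolynomial 1 = X ^ 2 := by
  classical
  refine eq_of_forall_eval_natCast fun N => ?_
  have : Fintype.card (ChordDiagram 1) = 1 := by simpa using ChordDiagram.card_mul 1
  rw [eval_boundaryPolynomial, this, eval_pow, eval_X]
  have h := Nat.choose_succ_right_eq N 1
  have : harerZagierSum 1 N = N ^ 2 := by
    rcases N with _ | N
    · simp [harerZagierSum]
    · simp only [harerZagierSum, Finset.sum_range_succ, Finset.sum_range_zero]
      simp at h ⊢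
      linear_combination h
  rw [this]
  push_cast
  ring

/-- The Harer–Zagier recursion, for the generating polynomials of the number of boundary
components. -/
lemma boundaryPolynomial_rec (n : ℕ) :
    ((n + 3 : ℕ) : ℤ[X]) * boundaryPolynomial (n + 2) =
      ((2 * (2 * n + 3) : ℕ) : ℤ[X]) * (X * boundaryPolynomial (n + 1)) +
      (((2 * n + 3) * (2 * n + 1) * (n + 1) : ℕ) : ℤ[X]) * boundaryPolynomial n := by
  classical
  refine eq_of_forall_eval_natCast fun N => ?_
  simp only [eval_add, eval_mul, eval_natCast, eval_X, eval_boundaryPolynomial,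
    ChordDiagram.card_succ]
  have h := harerZagierSum_rec n N
  zify at h
  push_cast
  linear_combination (2 * n + 3) * (2 * n + 1) * (Fintype.card (ChordDiagram n) : ℤ) * h

lemma boundaryNumber_rec (n r : ℕ) :
    (n + 3) * boundaryNumber (n + 2) r =
      2 * (2 * n + 3) * (if r = 0 then 0 else boundaryNumber (n + 1) (r - 1)) +
      (2 * n + 3) * (2 * n + 1) * (n + 1) * boundaryNumber n r := by
  have h := congrArg (fun p => p.coeff r) (boundaryPolynomial_rec n)
  simp only [coeff_add, coeff_natCast_mul, coeff_boundaryPolynomial] at h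
  rcases r with _ | r
  · rw [coeff_X_mul_zero] at h
    simp only [if_true]
    exact_mod_cast h
  · rw [coeff_X_mul, coeff_boundaryPolynomial] at h
    rw [if_neg (Nat.succ_ne_zero r), Nat.add_sub_cancel]
    exact_mod_cast h

lemma boundaryNumber_zero (r : ℕ) : boundaryNumber 0 r = if r = 1 then 1 else 0 := by
  have h := coeff_boundaryPolynomial 0 r
  rw [boundaryPolynomial_zero, coeff_X, if_congr eq_comm rfl rfl] at h
  split_ifs at h ⊢ <;> exact_mod_cast h.symm

lemma boundaryNumber_one (r : ℕ) : boundaryNumber 1 r = if r = 2 then 1 else 0 := by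
  have h := coeff_boundaryPolynomial 1 r
  rw [boundaryPolynomial_one, coeff_X_pow] at h
  split_ifs at h ⊢ <;> exact_mod_cast h.symm

/-- The genus of a chord diagram is not negative. -/
lemma boundaryNumber_eq_zero {n r : ℕ} (h : n + 1 < r) : boundaryNumber n r = 0 := by
  induction n using Nat.twoStepInduction generalizing r with
  | zero => rw [boundaryNumber_zero, if_neg (by omega)]
  | one => rw [boundaryNumber_one, if_neg (by omega)]
  | more n ih1 ih2 =>
    have := boundaryNumber_rec n r
    rw [if_neg (by omega), ih1 (by omega), ih2 (by omega)] at this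
    simpa using this

lemma chordCount_eq (g n : ℕ) :
    chordCount g n = if 2 * g ≤ n + 1 then boundaryNumber n (n + 1 - 2 * g) else 0 := by
  classical
  rw [chordCount, Nat.card_eq_fintype_card, Fintype.card_subtype]
  split_ifs with h
  · rw [boundaryNumber]
    congr 1
    refine Finset.filter_congr fun C _ => ?_
    unfold ChordDiagram.HasGenus
    omega
  · rw [Finset.card_eq_zero, Finset.filter_eq_empty_iff]
    intro C _ hC
    unfold ChordDiagram.HasGenus at hC
    omega

/-- The Harer–Zagier recursion for chord diagrams of positive genus. -/
theorem chordCount_rec (g n : ℕ) :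
    (n + 3) * chordCount (g + 1) (n + 2) =
      2 * (2 * n + 3) * chordCount (g + 1) (n + 1) +
      (2 * n + 3) * (2 * n + 1) * (n + 1) * chordCount g n := by
  simp only [chordCount_eq]
  rcases le_or_gt (2 * (g + 1)) (n + 3) with h | h
  · rw [if_pos (by omega : 2 * (g + 1) ≤ n + 2 + 1), if_pos (by omega : 2 * g ≤ n + 1),
      boundaryNumber_rec]
    rw [show n + 2 + 1 - 2 * (g + 1) = n + 1 - 2 * g by omega]
    congr 2
    rcases Nat.eq_zero_or_pos (n + 1 - 2 * g) with h0 | h0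
    · rw [if_pos h0, if_neg (by omega)]
    · rw [if_neg h0.ne', if_pos (by omega)]
      congr 1
      omega
  · rw [if_neg (by omega), if_neg (by omega), if_neg (by omega)]
    simp

lemma chordCount_succ_zero (g : ℕ) : chordCount (g + 1) 0 = 0 := by
  rw [chordCount_eq, if_neg (by omega)]

lemma chordCount_succ_one (g : ℕ) : chordCount (g + 1) 1 = 0 := by
  rw [chordCount_eq, boundaryNumber_one, if_neg (by omega : ¬ 1 + 1 - 2 * (g + 1) = 2), ite_self]

/-- Diagrams of genus zero are counted by the Catalan numbers. -/
lemma chordCount_zero (n : ℕ) : (n + 1) * chordCount 0 n = n.centralBinom := by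
  have h : ∀ n, chordCount 0 n = boundaryNumber n (n + 1) := fun n => by
    rw [chordCount_eq, if_pos (by omega)]
    rfl
  simp only [h]
  induction n using Nat.twoStepInduction with
  | zero => simp [boundaryNumber_zero]
  | one =>
    rw [boundaryNumber_one, if_pos rfl]
    rfl
  | more n _ ih =>
    have h1 := boundaryNumber_rec n (n + 3)
    rw [if_neg (by omega), boundaryNumber_eq_zero (n := n) (by omega), mul_zero, add_zero] at h1
    have h2 := Nat.succ_mul_centralBinom_succ (n + 1)
    refine Nat.eq_of_mul_eq_mul_left (show 0 < n + 2 by omega) ?_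
    rw [h2, ← ih, h1]
    simp only [show n + 3 - 1 = n + 1 + 1 from rfl]
    ring

end Recursion

/-! ### Generating functions and the value at `1 / 4` -/

section Series

open PowerSeries

/-- The coefficient of `z ^ n` in `z ^ j * (1 - 4 z) ^ (-j - 1 / 2)`. -/
noncomputable def halfPowCoeff (j n : ℕ) : ℚ :=
  if j ≤ n then
    (2 * n).factorial * j.factorial / (n.factorial * (2 * j).factorial * (n - j).factorial)
  else 0

lemma two_mul_succ_factorial_div (n : ℕ) :
    ((2 * (n + 1)).factorial : ℚ) / (n + 1).factorial =
      (4 * n + 2) * ((2 * n).factorial / n.factorial) := by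
  rw [show 2 * (n + 1) = 2 * n + 1 + 1 by ring, Nat.factorial_succ, Nat.factorial_succ,
    Nat.factorial_succ]
  have : (n.factorial : ℚ) ≠ 0 := by exact_mod_cast n.factorial_ne_zero
  push_cast
  field_simp
  ring

lemma halfPowCoeff_eq {j n : ℕ} (h : j ≤ n) : halfPowCoeff j n =
    ((2 * n).factorial / n.factorial) / ((2 * j).factorial / j.factorial) / (n - j).factorial := by
  rw [halfPowCoeff, if_pos h]
  have h1 : (n.factorial : ℚ) ≠ 0 := by exact_mod_cast n.factorial_ne_zero
  have h2 : (j.factorial : ℚ) ≠ 0 := by exact_mod_cast j.factorial_ne_zero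
  have h3 : ((2 * j).factorial : ℚ) ≠ 0 := by exact_mod_cast (2 * j).factorial_ne_zero
  have h4 : ((n - j).factorial : ℚ) ≠ 0 := by exact_mod_cast (n - j).factorial_ne_zero
  field_simp

lemma halfPowCoeff_of_lt {j n : ℕ} (h : n < j) : halfPowCoeff j n = 0 := if_neg (by omega)

lemma halfPowCoeff_self (j : ℕ) : halfPowCoeff j j = 1 := by
  have h2 : (j.factorial : ℚ) ≠ 0 := by exact_mod_cast j.factorial_ne_zero
  have h3 : ((2 * j).factorial : ℚ) ≠ 0 := by exact_mod_cast (2 * j).factorial_ne_zero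
  rw [halfPowCoeff_eq le_rfl, Nat.sub_self, Nat.factorial_zero, Nat.cast_one, div_one, div_self]
  exact div_ne_zero h3 h2

lemma halfPowCoeff_succ_right (j n : ℕ) :
    ((n : ℚ) + 1 - j) * halfPowCoeff j (n + 1) = (4 * n + 2) * halfPowCoeff j n := by
  rcases lt_trichotomy j (n + 1) with h | h | h
  · obtain ⟨d, rfl⟩ := Nat.exists_eq_add_of_le (Nat.lt_succ_iff.1 h)
    have h4 : (d.factorial : ℚ) ≠ 0 := by exact_mod_cast d.factorial_ne_zero
    have h5 : (d : ℚ) + 1 ≠ 0 := by positivity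
    rw [halfPowCoeff_eq (by omega), halfPowCoeff_eq (by omega), two_mul_succ_factorial_div,
      show j + d + 1 - j = d + 1 by omega, Nat.add_sub_cancel_left, Nat.factorial_succ d]
    push_cast
    rw [show (j : ℚ) + d + 1 - j = d + 1 by ring, mul_div_assoc', mul_comm, div_mul_eq_mul_div,
      div_eq_iff (mul_ne_zero h5 h4)]
    field_simp
  · subst h
    rw [halfPowCoeff_of_lt (Nat.lt_succ_self n)]
    push_cast
    ring
  · rw [halfPowCoeff_of_lt h, halfPowCoeff_of_lt (by omega), mul_zero, mul_zero]

lemma halfPowCoeff_succ_left (j n : ℕ) :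
    (4 * (j : ℚ) + 2) * halfPowCoeff (j + 1) n = ((n : ℚ) - j) * halfPowCoeff j n := by
  rcases lt_trichotomy j n with h | h | h
  · obtain ⟨d, rfl⟩ := Nat.exists_eq_add_of_lt h
    have h0 : (4 * (j : ℚ) + 2) ≠ 0 := by positivity
    rw [halfPowCoeff_eq (by omega), halfPowCoeff_eq (by omega), two_mul_succ_factorial_div j,
      show j + d + 1 - (j + 1) = d by omega, show j + d + 1 - j = d + 1 by omega,
      Nat.factorial_succ d]
    have h4 : (d.factorial : ℚ) ≠ 0 := by exact_mod_cast d.factorial_ne_zero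
    have h5 : (d : ℚ) + 1 ≠ 0 := by positivity
    have h2 : (j.factorial : ℚ) ≠ 0 := by exact_mod_cast j.factorial_ne_zero
    have h3 : ((2 * j).factorial : ℚ) ≠ 0 := by exact_mod_cast (2 * j).factorial_ne_zero
    push_cast
    rw [show (j : ℚ) + d + 1 - j = d + 1 by ring]
    field_simp
  · subst h
    rw [halfPowCoeff_of_lt (Nat.lt_succ_self j), sub_self, mul_zero, zero_mul]
  · rw [halfPowCoeff_of_lt h, halfPowCoeff_of_lt (by omega), mul_zero, mul_zero]

lemma halfPowCoeff_zero_left (n : ℕ) : halfPowCoeff 0 n = n.centralBinom := by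
  rw [halfPowCoeff_eq (Nat.zero_le n), Nat.sub_zero, Nat.centralBinom_eq_two_mul_choose,
    Nat.cast_choose ℚ (by omega : n ≤ 2 * n), show 2 * n - n = n by omega]
  simp [div_div]

/-- The operator of the homogeneous part of the Harer–Zagier recursion is diagonal in the basis
`z ^ j * (1 - 4 z) ^ (-j - 1 / 2)`. -/
lemma halfPowCoeff_rec (j n : ℕ) :
    ((n : ℚ) + 3) * halfPowCoeff j (n + 2) - 2 * (2 * n + 3) * halfPowCoeff j (n + 1) =
      (j + 1) * halfPowCoeff j (n + 2) := by
  have h := halfPowCoeff_succ_right j (n + 1)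
  push_cast at h
  linear_combination h

/-- The operator of the inhomogeneous part raises `j` by two or three. -/
lemma halfPowCoeff_raise (j n : ℕ) :
    (2 * (n : ℚ) + 3) * (2 * n + 1) * (n + 1) * halfPowCoeff j n =
      (2 * j + 1) * (2 * j + 3) *
        ((j + 1) * halfPowCoeff (j + 2) (n + 2) + (4 * j + 10) * halfPowCoeff (j + 3) (n + 2)) := by
  have h1 := halfPowCoeff_succ_left (j + 2) (n + 2)
  have h2 := halfPowCoeff_succ_left (j + 1) (n + 2)
  have h3 := halfPowCoeff_succ_left j (n + 2)
  have h4 := halfPowCoeff_succ_right j (n + 1)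
  have h5 := halfPowCoeff_succ_right j n
  push_cast at h1 h2 h3 h4 h5
  linear_combination (-(2 * (j : ℚ) + 1) * (2 * j + 3)) * h1
    - ((n : ℚ) + 1) * (2 * j + 1) / 2 * h2
    - ((n : ℚ) + 1) * (n + 1 - j) / 4 * h3 - ((n : ℚ) + 1) * (n + 1 - j) / 4 * h4
    - ((n : ℚ) + 1) * (4 * n + 6) / 4 * h5

/-- The series of genus `g + 1` is `∑ j, numeratorCoeff g j * z ^ j * (1 - 4 z) ^ (-j - 1 / 2)`,
with `j ≤ 3 g + 2`. -/
noncomputable def numeratorCoeff : ℕ → ℕ → ℚ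
  | 0, j => if j = 2 then 1 else 0
  | g + 1, j =>
    ((if 2 ≤ j then (2 * ((j - 2 : ℕ) : ℚ) + 1) * (2 * ((j - 2 : ℕ) : ℚ) + 3) *
        (((j - 2 : ℕ) : ℚ) + 1) * numeratorCoeff g (j - 2) else 0) +
      (if 3 ≤ j then (2 * ((j - 3 : ℕ) : ℚ) + 1) * (2 * ((j - 3 : ℕ) : ℚ) + 3) *
        (4 * ((j - 3 : ℕ) : ℚ) + 10) * numeratorCoeff g (j - 3) else 0)) / (j + 1)

lemma numeratorCoeff_eq_zero {g j : ℕ} (h : 3 * g + 2 < j) : numeratorCoeff g j = 0 := by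
  induction g generalizing j with
  | zero => exact if_neg (by omega)
  | succ g ih =>
    rw [numeratorCoeff, ih (by omega), ih (by omega)]
    simp

lemma sum_range_add_ite (u : ℕ → ℚ) (F : ℕ → ℚ) (k m : ℕ) :
    ∑ j ∈ Finset.range (m + k), (if k ≤ j then u (j - k) else 0) * F j =
      ∑ i ∈ Finset.range m, u i * F (i + k) := by
  rw [add_comm m k, Finset.sum_range_add, Finset.sum_eq_zero, zero_add]
  · refine Finset.sum_congr rfl fun i _ => ?_
    rw [if_pos (Nat.le_add_right k i), Nat.add_sub_cancel_left, add_comm k]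
  · intro j hj
    rw [if_neg (by simpa using hj), zero_mul]

/-- The recursion determines the series of positive genus. -/
theorem chordCount_succ_eq_sum (g n : ℕ) : (chordCount (g + 1) n : ℚ) =
    ∑ j ∈ Finset.range (3 * g + 3), numeratorCoeff g j * halfPowCoeff j n := by
  have hzero : ∀ g, numeratorCoeff g 0 = 0 ∧ numeratorCoeff g 1 = 0 := by
    intro g
    rcases g with _ | g <;> simp [numeratorCoeff]
  have hlow : ∀ g n, n ≤ 1 →
      ∑ j ∈ Finset.range (3 * g + 3), numeratorCoeff g j * halfPowCoeff j n = 0 := by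
    intro g n hn
    refine Finset.sum_eq_zero fun j _ => ?_
    rcases j with _ | _ | j
    · rw [(hzero g).1, zero_mul]
    · rw [(hzero g).2, zero_mul]
    · rw [halfPowCoeff_of_lt (by omega), mul_zero]
  induction g generalizing n with
  | zero =>
    rw [Finset.sum_eq_single 2 (fun j _ hj => by rw [numeratorCoeff, if_neg hj, zero_mul])
      (by simp)]
    rw [numeratorCoeff, if_pos rfl, one_mul]
    induction n using Nat.twoStepInduction with
    | zero => rw [chordCount_succ_zero, halfPowCoeff_of_lt (by omega), Nat.cast_zero]
    | one => rw [chordCount_succ_one, halfPowCoeff_of_lt (by omega), Nat.cast_zero]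
    | more n _ ih =>
      have h1 : (((n + 3) * chordCount (0 + 1) (n + 2) : ℕ) : ℚ) = _ :=
        congrArg Nat.cast (chordCount_rec 0 n)
      have h2 : (((n + 1) * chordCount 0 n : ℕ) : ℚ) = _ := congrArg Nat.cast (chordCount_zero n)
      have h3 := halfPowCoeff_rec 2 n
      have h4 := halfPowCoeff_succ_left 1 (n + 2)
      have h5 := halfPowCoeff_succ_left 0 (n + 2)
      have h6 := halfPowCoeff_succ_right 0 (n + 1)
      have h7 := halfPowCoeff_succ_right 0 n
      rw [← halfPowCoeff_zero_left] at h2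
      push_cast at h1 h2 h3 h4 h5 h6 h7
      rw [ih] at h1
      refine mul_left_cancel₀ (show (n : ℚ) + 3 ≠ 0 by positivity) ?_
      linear_combination h1 - h3 + (2 * (n : ℚ) + 3) * (2 * n + 1) * h2 - h4 / 2
        - ((n : ℚ) + 1) / 4 * h5 - ((n : ℚ) + 1) / 4 * h6 - (4 * (n : ℚ) + 6) / 4 * h7
  | succ g ih =>
    induction n using Nat.twoStepInduction with
    | zero => rw [chordCount_succ_zero, hlow _ _ (by omega), Nat.cast_zero]
    | one => rw [chordCount_succ_one, hlow _ _ (by omega), Nat.cast_zero]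
    | more n _ ihn =>
      have h1 : (((n + 3) * chordCount (g + 1 + 1) (n + 2) : ℕ) : ℚ) = _ :=
        congrArg Nat.cast (chordCount_rec (g + 1) n)
      push_cast at h1
      rw [ihn, ih] at h1
      refine mul_left_cancel₀ (show (n : ℚ) + 3 ≠ 0 by positivity) ?_
      have h2 : ((n : ℚ) + 3) * ∑ j ∈ Finset.range (3 * (g + 1) + 3),
            numeratorCoeff (g + 1) j * halfPowCoeff j (n + 2) -
          2 * (2 * n + 3) * ∑ j ∈ Finset.range (3 * (g + 1) + 3),
            numeratorCoeff (g + 1) j * halfPowCoeff j (n + 1) =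
          ∑ j ∈ Finset.range (3 * (g + 1) + 3),
            ((j + 1) * numeratorCoeff (g + 1) j) * halfPowCoeff j (n + 2) := by
        rw [Finset.mul_sum, Finset.mul_sum, ← Finset.sum_sub_distrib]
        refine Finset.sum_congr rfl fun j _ => ?_
        linear_combination numeratorCoeff (g + 1) j * halfPowCoeff_rec j n
      have h3 : ∀ j : ℕ, ((j : ℚ) + 1) * numeratorCoeff (g + 1) j =
          (if 2 ≤ j then (fun i : ℕ => (2 * (i : ℚ) + 1) * (2 * i + 3) * (i + 1) *
            numeratorCoeff g i) (j - 2) else 0) +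
          (if 3 ≤ j then (fun i : ℕ => (2 * (i : ℚ) + 1) * (2 * i + 3) * (4 * i + 10) *
            numeratorCoeff g i) (j - 3) else 0) := by
        intro j
        rw [numeratorCoeff, mul_div_cancel₀ _ (show (j : ℚ) + 1 ≠ 0 by positivity)]
      have h5 : ∑ j ∈ Finset.range (3 * (g + 1) + 3),
          ((j + 1) * numeratorCoeff (g + 1) j) * halfPowCoeff j (n + 2) =
          ∑ i ∈ Finset.range (3 * g + 3), ((2 * (i : ℚ) + 1) * (2 * i + 3) * (i + 1) *
            numeratorCoeff g i * halfPowCoeff (i + 2) (n + 2) +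
            (2 * (i : ℚ) + 1) * (2 * i + 3) * (4 * i + 10) *
            numeratorCoeff g i * halfPowCoeff (i + 3) (n + 2)) := by
        rw [Finset.sum_congr rfl fun j _ => (congrArg (· * _) (h3 j)).trans (add_mul _ _ _),
          Finset.sum_add_distrib, Finset.sum_add_distrib]
        refine congrArg₂ (· + ·) ?_ ?_
        · refine (sum_range_add_ite (fun i : ℕ => (2 * (i : ℚ) + 1) * (2 * i + 3) * (i + 1) *
            numeratorCoeff g i) (fun j => halfPowCoeff j (n + 2)) 2 (3 * g + 3 + 1)).trans ?_
          rw [Finset.sum_range_succ, numeratorCoeff_eq_zero (j := 3 * g + 3) (by omega),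
            mul_zero, zero_mul, add_zero]
        · exact sum_range_add_ite (fun i : ℕ => (2 * (i : ℚ) + 1) * (2 * i + 3) * (4 * i + 10) *
            numeratorCoeff g i) (fun j => halfPowCoeff j (n + 2)) 3 (3 * g + 3)
      have h4 : (2 * (n : ℚ) + 3) * (2 * n + 1) * (n + 1) *
          ∑ j ∈ Finset.range (3 * g + 3), numeratorCoeff g j * halfPowCoeff j n =
          ∑ i ∈ Finset.range (3 * g + 3), ((2 * (i : ℚ) + 1) * (2 * i + 3) * (i + 1) *
            numeratorCoeff g i * halfPowCoeff (i + 2) (n + 2) +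
            (2 * (i : ℚ) + 1) * (2 * i + 3) * (4 * i + 10) *
            numeratorCoeff g i * halfPowCoeff (i + 3) (n + 2)) := by
        rw [Finset.mul_sum]
        refine Finset.sum_congr rfl fun j _ => ?_
        linear_combination numeratorCoeff g j * halfPowCoeff_raise j n
      linear_combination h1 - h2 - h5 + h4

lemma oneSubFourPow_add (s t : ℚ) : oneSubFourPow (s + t) = oneSubFourPow s * oneSubFourPow t := by
  rw [oneSubFourPow, binomialSeries_add, map_mul]
  rfl

lemma oneSubFourPow_natCast (k : ℕ) : oneSubFourPow (k : ℚ) = (1 - 4 * X) ^ k := by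
  rw [oneSubFourPow, binomialSeries_nat, map_pow, map_add, map_one, rescale_X]
  congr 1
  rw [show (C (-4 : ℚ) : ℚ⟦X⟧) = -4 by rw [map_neg]; rfl]
  ring

lemma oneSubFourPow_mul_neg (s : ℚ) : oneSubFourPow s * oneSubFourPow (-s) = 1 := by
  rw [← oneSubFourPow_add, add_neg_cancel]
  simpa using oneSubFourPow_natCast 0

lemma coeff_oneSubFourPow (j m : ℕ) :
    coeff m (oneSubFourPow (-(j : ℚ) - 1 / 2)) = halfPowCoeff j (j + m) := by
  have hc : ∀ m, coeff m (oneSubFourPow (-(j : ℚ) - 1 / 2)) =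
      (-4) ^ m * Ring.choose (-(j : ℚ) - 1 / 2) m := by
    intro m
    rw [oneSubFourPow, coeff_rescale, binomialSeries_coeff, smul_eq_mul, mul_one]
  rw [hc]
  induction m with
  | zero => rw [add_zero, halfPowCoeff_self, Ring.choose_zero_right, pow_zero, one_mul]
  | succ m ih =>
    have h1 := Ring.choose_add_smul_choose (-(j : ℚ) - 1 / 2 - m) 1 m
    have h2 := halfPowCoeff_succ_right j (j + m)
    rw [Ring.choose_one_right, sub_add_cancel, add_comm 1 m, Nat.choose_succ_self_right,
      nsmul_eq_mul] at h1
    rw [← ih] at h2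
    refine mul_left_cancel₀ (show (m : ℚ) + 1 ≠ 0 by positivity) ?_
    push_cast at h1 h2
    rw [← add_assoc, pow_succ]
    linear_combination (-4) ^ m * (-4) * h1 - h2

lemma coeff_X_pow_mul_oneSubFourPow (j n : ℕ) :
    coeff n (X ^ j * oneSubFourPow (-(j : ℚ) - 1 / 2)) = halfPowCoeff j n := by
  rw [coeff_X_pow_mul']
  split_ifs with h
  · rw [coeff_oneSubFourPow, Nat.add_sub_cancel' h]
  · rw [halfPowCoeff_of_lt (by omega)]

/-- The numerator of genus `g + 1`, with rational coefficients. -/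
noncomputable def numeratorPolynomial (g : ℕ) : Polynomial ℚ :=
  ∑ j ∈ Finset.range (3 * g + 3), Polynomial.C (numeratorCoeff g j) *
    (Polynomial.X ^ j * (1 - 4 * Polynomial.X) ^ (3 * g + 2 - j))

lemma chordSeries_succ_eq (g : ℕ) : chordSeries (g + 1) =
    (numeratorPolynomial g : ℚ⟦X⟧) * oneSubFourPow (1 / 2 - 3 * ((g + 1 : ℕ) : ℚ)) := by
  ext n
  have hcoe : (numeratorPolynomial g : ℚ⟦X⟧) = ∑ j ∈ Finset.range (3 * g + 3),
      C (numeratorCoeff g j) * (X ^ j * (1 - 4 * X) ^ (3 * g + 2 - j)) := by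
    rw [numeratorPolynomial, ← Polynomial.coeToPowerSeries.ringHom_apply, map_sum]
    refine Finset.sum_congr rfl fun j _ => ?_
    simp only [map_mul, map_pow, map_sub, map_one, map_ofNat,
      Polynomial.coeToPowerSeries.ringHom_apply, Polynomial.coe_C, Polynomial.coe_X]
  rw [chordSeries, coeff_mk, chordCount_succ_eq_sum, hcoe, Finset.sum_mul, map_sum]
  refine Finset.sum_congr rfl fun j hj => ?_
  have hj' : j ≤ 3 * g + 2 := by simpa [Nat.lt_succ_iff] using hj
  have hexp : (-(j : ℚ) - 1 / 2) = ((3 * g + 2 - j : ℕ) : ℚ) + (1 / 2 - 3 * ((g + 1 : ℕ) : ℚ)) := by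
    rw [Nat.cast_sub hj']
    push_cast
    ring
  rw [← coeff_X_pow_mul_oneSubFourPow, hexp, oneSubFourPow_add, oneSubFourPow_natCast,
    mul_assoc, mul_assoc, coeff_C_mul]

/-- The numerator is the product of the series with `(1 - 4 z) ^ (3 g + 3) * (1 - 4 z) ^ (-1 / 2)`,
and the last factor is the generating function of the central binomial coefficients. -/
lemma exists_int_numerator (g : ℕ) :
    ∃ P : Polynomial ℤ, P.map (Int.castRingHom ℚ) = numeratorPolynomial g := by
  rw [← Polynomial.mem_lifts, Polynomial.lifts_iff_coeff_lifts]
  intro n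
  have hbinom : oneSubFourPow (-1 / 2) =
      PowerSeries.map (Int.castRingHom ℚ) (mk fun n => (n.centralBinom : ℤ)) := by
    ext n
    have h := coeff_oneSubFourPow 0 n
    rw [zero_add, halfPowCoeff_zero_left, Nat.cast_zero, neg_zero, zero_sub, ← neg_div] at h
    rw [h, coeff_map, coeff_mk]
    simp
  have hchord : chordSeries (g + 1) =
      PowerSeries.map (Int.castRingHom ℚ) (mk fun n => (chordCount (g + 1) n : ℤ)) := by
    ext n
    rw [chordSeries, coeff_map, coeff_mk, coeff_mk]
    simp
  have hlin : oneSubFourPow ((3 * g + 3 : ℕ) : ℚ) =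
      PowerSeries.map (Int.castRingHom ℚ) ((1 - 4 * X) ^ (3 * g + 3)) := by
    rw [oneSubFourPow_natCast, map_pow, map_sub, map_one, map_mul, map_X,
      map_ofNat (PowerSeries.map (Int.castRingHom ℚ)) 4]
  have h : (numeratorPolynomial g : ℚ⟦X⟧) = chordSeries (g + 1) *
      (oneSubFourPow ((3 * g + 3 : ℕ) : ℚ) * oneSubFourPow (-1 / 2)) := by
    rw [chordSeries_succ_eq, ← oneSubFourPow_add, mul_assoc, ← oneSubFourPow_add]
    rw [show (1 / 2 - 3 * ((g + 1 : ℕ) : ℚ) + (((3 * g + 3 : ℕ) : ℚ) + -1 / 2)) = ((0 : ℕ) : ℚ) by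
      push_cast; ring, oneSubFourPow_natCast, pow_zero, mul_one]
  rw [hbinom, hchord, hlin, ← map_mul, ← map_mul] at h
  rw [← Polynomial.coeff_coe, h, coeff_map]
  exact ⟨_, rfl⟩

lemma IsNumerator.map_eq {g : ℕ} {P : Polynomial ℤ} (h : IsNumerator (g + 1) P) :
    P.map (Int.castRingHom ℚ) = numeratorPolynomial g := by
  refine Polynomial.coe_injective ℚ ?_
  rw [IsNumerator, chordSeries_succ_eq] at h
  have h' := congrArg (· * oneSubFourPow (-(1 / 2 - 3 * ((g + 1 : ℕ) : ℚ)))) h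
  simp only [mul_assoc, oneSubFourPow_mul_neg, mul_one] at h'
  exact h'.symm

lemma existsUnique_isNumerator (g : ℕ) : ∃! P : Polynomial ℤ, IsNumerator (g + 1) P := by
  obtain ⟨P, hP⟩ := exists_int_numerator g
  refine ⟨P, ?_, fun Q hQ => ?_⟩
  · change chordSeries (g + 1) = _
    rw [hP]
    exact chordSeries_succ_eq g
  · exact Polynomial.map_injective _ (RingHom.injective_int _) (hQ.map_eq.trans hP.symm)

/-- Only the summand without a factor `1 - 4 z` survives at `z = 1 / 4`. -/
lemma eval_numeratorPolynomial (g : ℕ) : (numeratorPolynomial g).eval (1 / 4) =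
    numeratorCoeff g (3 * g + 2) * (1 / 4) ^ (3 * g + 2) := by
  rw [numeratorPolynomial, Polynomial.eval_finsetSum, Finset.sum_range_succ, Finset.sum_eq_zero]
  · simp
  · intro j hj
    have hj : j < 3 * g + 2 := by simpa using hj
    simp [show 3 * g + 2 - j ≠ 0 by omega]

lemma numeratorCoeff_top_succ (g : ℕ) : numeratorCoeff (g + 1) (3 * (g + 1) + 2) =
    (6 * g + 5) * (6 * g + 7) * (12 * g + 18) / (3 * g + 6) * numeratorCoeff g (3 * g + 2) := by
  rw [numeratorCoeff, if_pos (by omega), if_pos (by omega),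
    numeratorCoeff_eq_zero (j := 3 * (g + 1) + 2 - 2) (by omega),
    show 3 * (g + 1) + 2 - 3 = 3 * g + 2 by omega]
  push_cast
  ring

/-- The value at genus one uses the reflection formula for `Γ (1 / 6) * Γ (5 / 6)`, and the values
at higher genus follow from the functional equation of the Gamma function. -/
lemma numeratorCoeff_top_eq_gamma (g : ℕ) :
    ((numeratorCoeff g (3 * g + 2) * (1 / 4) ^ (3 * g + 2) : ℚ) : ℝ) =
      (9 / 4 : ℝ) ^ (g + 1) *
        (Real.Gamma (((g + 1 : ℕ) : ℝ) - 1 / 6) * Real.Gamma (((g + 1 : ℕ) : ℝ) + 1 / 2) *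
            Real.Gamma (((g + 1 : ℕ) : ℝ) + 1 / 6) /
          (6 * Real.pi ^ (3 / 2 : ℝ) * Real.Gamma (((g + 1 : ℕ) : ℝ) + 1))) := by
  have hpi : Real.pi ^ (3 / 2 : ℝ) = Real.pi * √Real.pi := by
    rw [show (3 / 2 : ℝ) = 1 + 1 / 2 by norm_num, Real.rpow_add Real.pi_pos, Real.rpow_one,
      Real.sqrt_eq_rpow]
  induction g with
  | zero =>
    have h1 := Real.Gamma_mul_Gamma_one_sub (1 / 6)
    rw [show Real.pi * (1 / 6) = Real.pi / 6 by ring, Real.sin_pi_div_six] at h1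
    have h2 : Real.Gamma (((0 + 1 : ℕ) : ℝ) + 1 / 6) = 1 / 6 * Real.Gamma (1 / 6) := by
      rw [← Real.Gamma_add_one (by norm_num)]
      norm_num
    have h3 : Real.Gamma (((0 + 1 : ℕ) : ℝ) + 1 / 2) = 1 / 2 * √Real.pi := by
      rw [← Real.Gamma_one_half_eq, ← Real.Gamma_add_one (by norm_num)]
      norm_num
    have h4 : Real.Gamma (((0 + 1 : ℕ) : ℝ) + 1) = 1 := by
      norm_num
    rw [h2, h3, h4, hpi]
    have h5 : (((0 + 1 : ℕ) : ℝ) - 1 / 6) = 1 - 1 / 6 := by norm_num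
    rw [h5]
    have h6 : √Real.pi ≠ 0 := (Real.sqrt_pos.2 Real.pi_pos).ne'
    have h7 := Real.pi_ne_zero
    have h8 : Real.Gamma (1 - 1 / 6) * (1 / 2 * √Real.pi) * (1 / 6 * Real.Gamma (1 / 6)) =
        Real.pi * √Real.pi / 6 := by
      linear_combination √Real.pi / 12 * h1
    rw [h8, show numeratorCoeff 0 (3 * 0 + 2) = 1 from if_pos rfl]
    field_simp
    norm_num
  | succ g ih =>
    have hg : (0 : ℝ) ≤ g := Nat.cast_nonneg g
    have h1 : ∀ a b : ℝ, a = b + 1 → 0 < b → Real.Gamma a = b * Real.Gamma b := by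
      rintro a b rfl hb
      exact Real.Gamma_add_one hb.ne'
    rw [h1 (((g + 1 + 1 : ℕ) : ℝ) - 1 / 6) (((g + 1 : ℕ) : ℝ) - 1 / 6) (by push_cast; ring)
        (by push_cast; linarith),
      h1 (((g + 1 + 1 : ℕ) : ℝ) + 1 / 2) (((g + 1 : ℕ) : ℝ) + 1 / 2) (by push_cast; ring)
        (by push_cast; linarith),
      h1 (((g + 1 + 1 : ℕ) : ℝ) + 1 / 6) (((g + 1 : ℕ) : ℝ) + 1 / 6) (by push_cast; ring)
        (by push_cast; linarith),
      h1 (((g + 1 + 1 : ℕ) : ℝ) + 1) (((g + 1 : ℕ) : ℝ) + 1) (by push_cast; ring)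
        (by push_cast; linarith)]
    have hgam : Real.Gamma (((g + 1 : ℕ) : ℝ) + 1) ≠ 0 :=
      (Real.Gamma_pos_of_pos (by push_cast; linarith)).ne'
    rw [numeratorCoeff_top_succ, show 3 * (g + 1) + 2 = 3 * g + 2 + 3 by ring, pow_add]
    have hstep : ((((6 * g + 5) * (6 * g + 7) * (12 * g + 18) / (3 * g + 6) *
        numeratorCoeff g (3 * g + 2)) * ((1 / 4) ^ (3 * g + 2) * (1 / 4) ^ 3) : ℚ) : ℝ) =
        ((6 * g + 5) * (6 * g + 7) * (12 * g + 18) / (3 * g + 6) / 64) *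
        ((numeratorCoeff g (3 * g + 2) * (1 / 4) ^ (3 * g + 2) : ℚ) : ℝ) := by
      push_cast
      ring
    rw [hstep, ih, hpi]
    have h6 : √Real.pi ≠ 0 := (Real.sqrt_pos.2 Real.pi_pos).ne'
    have h7 := Real.pi_ne_zero
    have h9 : (3 * (g : ℝ) + 6) ≠ 0 := by positivity
    have h10 : (((g + 1 : ℕ) : ℝ) + 1) ≠ 0 := by positivity
    generalize Real.Gamma (((g + 1 : ℕ) : ℝ) + 1) = c at hgam
    generalize Real.Gamma (((g + 1 : ℕ) : ℝ) - 1 / 6) = a₁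
    generalize Real.Gamma (((g + 1 : ℕ) : ℝ) + 1 / 2) = a₂
    generalize Real.Gamma (((g + 1 : ℕ) : ℝ) + 1 / 6) = a₃
    rw [pow_succ _ (g + 1)]
    push_cast at h10 ⊢
    field_simp
    ring

end Series

theorem lemma2p2 (g : ℕ) (hg : 1 ≤ g) :
    (∃! P : Polynomial ℤ, IsNumerator g P) ∧
      ∀ P : Polynomial ℤ, IsNumerator g P →
        Polynomial.aeval (1 / 4 : ℝ) P =
          (9 / 4 : ℝ) ^ g *
            (Real.Gamma ((g : ℝ) - 1 / 6) * Real.Gamma ((g : ℝ) + 1 / 2) *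
                Real.Gamma ((g : ℝ) + 1 / 6) /
              (6 * Real.pi ^ (3 / 2 : ℝ) * Real.Gamma ((g : ℝ) + 1))) := by
  obtain ⟨g, rfl⟩ := Nat.exists_eq_succ_of_ne_zero (by omega : g ≠ 0)
  refine ⟨existsUnique_isNumerator g, fun P hP => ?_⟩
  rw [Nat.succ_eq_add_one, ← numeratorCoeff_top_eq_gamma, ← eval_numeratorPolynomial,
    ← IsNumerator.map_eq hP]
  have h := Polynomial.aeval_algebraMap_apply ℝ (1 / 4 : ℚ) P
  rw [Polynomial.eval_map, ← algebraMap_int_eq, ← Polynomial.aeval_def,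
    ← eq_ratCast (algebraMap ℚ ℝ), ← h]
  norm_num
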